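/- Let $\mathbb T=\mathbb R/\mathbb Z$. Let $\Phi$ be an even $C^\infty$ function on $\mathbb R$ with $\Phi(s)=1$ for $|s|\le 1$ and supported in $(-2,2)$; put $\phi_0=\Phi$ and $\phi_k(s)=\Phi(2^{-k}s)-\Phi(2^{-k+1}s)$ for $k\ge 1$. For a distribution $u$ on $\mathbb T$ with Fourier coefficients $\widehat u(n)$ let $L_ku(x)=\sum_{n\in\mathbb Z}\phi_k(n)\,\widehat u(n)\,e^{2\pi i n x}$, and for $q\geq 1$ let $B^\infty_{0,q}$ be the space of distributions $u$ on $\mathbb T$ for which $$\|u\|_{B^\infty_{0,q}}=\Big(\sum_{k=0}^\infty\|L_ku\|_\infty^q\Big)^{1/q}$$ is finite. For an integrable function $f$ on $\mathbb T$ let $f^*(t)=\inf\{s\ge 0:\ |\{x\in\mathbb T:|f(x)|>s\}|\le t\}$ be its nonincreasing rearrangement. **Corollary 1.2.** Let $1\le q\le 2$ and let $q'$ be given by $\frac1q+\frac1{q'}=1$ (so $1/q'=0$ if $q=1$). Then every distribution in $B^\infty_{0,q}$ is an integrable function, and the growth envelope $$\mathcal E_q(t)=\sup\{f^*(t):\ \|f\|_{B^\infty_{0,q}}\le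 1\}$$ satisfies $\mathcal E_q(t)\approx|\log t|^{1/q'}$ for $0<t\le 1/2$; that is, there are constants $0<c\le C<\infty$, depending only on $q$ and $\Phi$, such that $$c\,|\log t|^{1/q'}\ \le\ \mathcal E_q(t)\ \le\ C\,|\log t|^{1/q'}\qquad\text{for all } 0<t\le \tfrac12 .$$ -/

import Mathlib

open MeasureTheory
open scoped ENNReal ContDiff

noncomputable section

namespace LowReg

/-- The lift of a function on the torus `ℝ/ℤ` to a `1`-periodic function on `ℝ`. -/
def lift (φ : UnitAddCircle → ℂ) : ℝ → ℂ := fun x => φ (x : UnitAddCircle)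

/-- The space `C^∞(𝕋)` of smooth complex functions on the torus, i.e. of functions whose
periodic lift to `ℝ` is infinitely differentiable. -/
def SmoothTorus : Submodule ℂ (UnitAddCircle → ℂ) where
  carrier := {φ | ContDiff ℝ ∞ (lift φ)}
  add_mem' := by
    intro a b (ha : ContDiff ℝ ∞ (lift a)) (hb : ContDiff ℝ ∞ (lift b))
    exact ha.add hb
  zero_mem' := (contDiff_const : ContDiff ℝ ∞ (fun _ : ℝ => (0 : ℂ)))
  smul_mem' := by
    intro c a (ha : ContDiff ℝ ∞ (lift a))
    exact contDiff_const.mul ha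

/-- The norm `∑_{j ≤ N} ‖φ^{(j)}‖_∞` on `C^∞(𝕋)`. (All derivatives are continuous and periodic,
so that the suprema are over bounded sets.) -/
def smoothNorm (N : ℕ) (φ : SmoothTorus) : ℝ :=
  ∑ j ∈ Finset.range (N + 1), ⨆ x : ℝ, ‖iteratedDeriv j (lift φ.1) x‖

/-- Distributions on the torus: linear functionals on `C^∞(𝕋)` which are continuous for the
topology defined by the norms `smoothNorm N`, `N = 0, 1, 2, …`. -/
structure TorusDistribution where
  toLinearMap : SmoothTorus →ₗ[ℂ] ℂ
  continuous' : ∃ (N : ℕ) (C : ℝ), ∀ φ : SmoothTorus, ‖toLinearMap φ‖ ≤ C * smoothNorm N φ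

lemma fourier_mem_smoothTorus (n : ℤ) :
    (fun x : UnitAddCircle => fourier n x) ∈ SmoothTorus := by
  change ContDiff ℝ ∞ (fun x : ℝ => (fourier n (x : UnitAddCircle) : ℂ))
  simp only [fourier_coe_apply]
  have h : ContDiff ℝ ∞ (fun x : ℝ => (x : ℂ)) := Complex.ofRealCLM.contDiff
  fun_prop

/-- The smooth function `x ↦ e^{2π i n x}` on the torus. -/
def expTest (n : ℤ) : SmoothTorus := ⟨fun x => fourier n x, fourier_mem_smoothTorus n⟩

/-- The `n`-th Fourier coefficient `û(n) = ⟨u, e^{-2π i n x}⟩` of a distribution on the torus. -/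
def TorusDistribution.coeff (u : TorusDistribution) (n : ℤ) : ℂ := u.toLinearMap (expTest (-n))

/-- The distribution `u` is (given by integration against) the integrable function `f`. -/
def TorusDistribution.IsFunction (u : TorusDistribution) (f : UnitAddCircle → ℂ) : Prop :=
  Integrable f ∧ ∀ φ : SmoothTorus, u.toLinearMap φ = ∫ x : UnitAddCircle, f x * φ.1 x

/-- The admissible cutoff functions: even, smooth, equal to `1` on `[-1,1]`, supported
in `(-2,2)`. -/
structure IsCutoff (Φ : ℝ → ℂ) : Prop where
  even : ∀ s, Φ (-s) = Φ s
  smooth : ContDiff ℝ ∞ Φ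
  eq_one : ∀ s, |s| ≤ 1 → Φ s = 1
  support : Function.support Φ ⊆ Set.Ioo (-2) 2

/-- `φ₀ = Φ` and `φ_k(s) = Φ(2^{-k} s) - Φ(2^{-k+1} s)` for `k ≥ 1`. -/
def dyadicCutoff (Φ : ℝ → ℂ) : ℕ → ℝ → ℂ
  | 0 => Φ
  | k + 1 => fun s => Φ (s / 2 ^ (k + 1)) - Φ (s / 2 ^ k)

/-- `L_k u(x) = ∑ₙ φ_k(n) û(n) e^{2π i n x}`, a finite sum when `Φ` is an admissible cutoff. -/
def littlewoodPaley (Φ : ℝ → ℂ) (k : ℕ) (u : TorusDistribution) (x : UnitAddCircle) : ℂ :=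
  ∑' n : ℤ, dyadicCutoff Φ k (n : ℝ) * u.coeff n * fourier n x

/-- The norm `(∑_k ‖L_k u‖_∞^q)^{1/q}` of `B^∞_{0,q}`, with values in `[0,∞]`. -/
def besovNorm (Φ : ℝ → ℂ) (q : ℝ) (u : TorusDistribution) : ℝ≥0∞ :=
  (∑' k : ℕ, (⨆ x : UnitAddCircle, ‖littlewoodPaley Φ k u x‖ₑ) ^ q) ^ (1 / q)

/-- The space `B^∞_{0,q}` of all distributions on the torus whose Besov norm is finite. -/
def besovSpace (Φ : ℝ → ℂ) (q : ℝ) : Set TorusDistribution := {u | besovNorm Φ q u < ⊤}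

/-- The nonincreasing rearrangement `f^*(t) = inf {s ≥ 0 : |{x : |f(x)| > s}| ≤ t}`. -/
def rearrangement (f : UnitAddCircle → ℂ) (t : ℝ) : ℝ≥0∞ :=
  sInf {s : ℝ≥0∞ | volume {x : UnitAddCircle | s < ‖f x‖ₑ} ≤ ENNReal.ofReal t}

/-- The growth envelope `𝓔_q(t) = sup {f^*(t) : ‖f‖_{B^∞_{0,q}} ≤ 1}`, as an element of `[0,∞]`. -/
def growthEnvelope (Φ : ℝ → ℂ) (q : ℝ) (t : ℝ) : ℝ≥0∞ :=
  sSup {r : ℝ≥0∞ | ∃ (u : TorusDistribution) (f : UnitAddCircle → ℂ),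
    u ∈ besovSpace Φ q ∧ besovNorm Φ q u ≤ 1 ∧ u.IsFunction f ∧ r = rearrangement f t}

end LowReg

end

/-!
The blocks `L_k u` of a distribution `u` in `B^∞_{0,q}`, `q ≤ 2`, are square summable in the uniform
norm. Since `φ_k + φ_{k+1} = 1` at every frequency for a suitable `k`, Parseval's identity puts the
Fourier coefficients of `u` into `ℓ²`, so `u` is an `L²` function `f` and the partial sums of
`∑ L_k u` converge to `f` in measure (`exists_isFunction_and_tendsto`). As the Fourier series of a
smooth function converges in all the norms `smoothNorm N`, distributions are determined by their
Fourier coefficients, and an integrable function representing `u` is unique almost everywhere.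

For the upper bound put `a_k = ‖L_k u‖_∞`, so that `∑ a_k ^ q ≤ 1`, and `L = |log t|`. The blocks
with `a_k > L ^ (-1/q)` sum up to at most `L ^ (1 - 1/q)` in the uniform norm, while the others have
square sum at most `σ = L ^ (1 - 2/q)`. The sum of the latter has a Gaussian tail
`exp (-c * s ^ 2 / σ)`; at `s = A * L ^ (1 - 1/q)` this is `exp (-c * A ^ 2 * L)`, which is less
than `t` if `A` is large. The Gaussian tail is `measure_lacunary_gt_le`: within a residue class of
`k` modulo three, the frequencies of the blocks are so sparse that a product of factors
`c_k + s_k * Re L_k u` has integral `∏ c_k` (a Riesz product, `integral_rieszProduct`), and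
`exp (lam * ∑ Re L_k u)` is dominated by such a product with `c_k = cosh (lam * a_k)`.

For the lower bound, the function `N ^ (-1/q) * ∑ exp (2 π i 2 ^ k x)`, `k < N`, has norm at most
one, because its blocks are its terms, and modulus at least `N ^ (1 - 1/q) / 2` on an interval of
length `2 ^ (-N - 1)` around the origin; `N` is taken to be the integer part of `|log t|`.
-/

noncomputable section

namespace LowReg

open Filter Topology

/-! ### Smooth functions on the torus and their Fourier series -/

lemma volume_eq_haarAddCircle : (volume : Measure UnitAddCircle) = AddCircle.haarAddCircle := by
  rw [AddCircle.volume_eq_smul_haarAddCircle]; simp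

lemma integrable_continuousMap (g : C(UnitAddCircle, ℂ)) : Integrable g volume :=
  g.continuous.integrable_of_hasCompactSupport (HasCompactSupport.of_compactSpace _)

/-- A smooth function on the torus as a continuous function. -/
def toCont : SmoothTorus →ₗ[ℂ] C(UnitAddCircle, ℂ) where
  toFun φ := ⟨φ.1, (QuotientAddGroup.isQuotientMap_mk
    (AddSubgroup.zmultiples (1 : ℝ))).continuous_iff.2
      (show ContDiff ℝ ∞ (lift φ.1) from φ.2).continuous⟩
  map_add' _ _ := rfl
  map_smul' _ _ := rfl

@[simp] lemma toCont_apply (φ : SmoothTorus) (x : UnitAddCircle) :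
    (toCont φ) x = φ.1 x := rfl

lemma contDiff_lift (φ : SmoothTorus) : ContDiff ℝ ∞ (lift φ.1) := φ.2

lemma lift_periodic (f : UnitAddCircle → ℂ) : Function.Periodic (lift f) 1 := by
  intro x
  simp [lift]

lemma periodic_deriv_lift (f : UnitAddCircle → ℂ) : Function.Periodic (deriv (lift f)) 1 := by
  intro x
  rw [← deriv_comp_add_const]
  congr 1
  funext y
  exact lift_periodic f y

lemma lift_periodicLift {g : ℝ → ℂ} (hg : Function.Periodic g 1) :
    lift (fun x : UnitAddCircle => hg.lift x) = g := by
  funext x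
  exact hg.lift_coe x

/-- Differentiation of smooth functions on the torus. -/
def torusDeriv : SmoothTorus →ₗ[ℂ] SmoothTorus where
  toFun φ := ⟨fun x => (periodic_deriv_lift φ.1).lift x, by
    change ContDiff ℝ ∞ (lift _)
    rw [lift_periodicLift]
    exact (contDiff_infty_iff_deriv.1 (contDiff_lift φ)).2⟩
  map_add' φ ψ := by
    ext x
    induction x using QuotientAddGroup.induction_on with | H x => ?_
    have h : lift (φ + ψ).1 = lift φ.1 + lift ψ.1 := rfl
    simp only [Submodule.coe_add, Pi.add_apply, Function.Periodic.lift_coe] at h ⊢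
    rw [h, deriv_add]
    · exact ((contDiff_infty_iff_deriv.1 (contDiff_lift φ)).1 x)
    · exact ((contDiff_infty_iff_deriv.1 (contDiff_lift ψ)).1 x)
  map_smul' c φ := by
    ext x
    induction x using QuotientAddGroup.induction_on with | H x => ?_
    have h : lift (c • φ).1 = c • lift φ.1 := rfl
    simp only [Submodule.coe_smul, Pi.smul_apply, Function.Periodic.lift_coe,
      RingHom.id_apply] at h ⊢
    rw [h, deriv_const_smul]
    exact ((contDiff_infty_iff_deriv.1 (contDiff_lift φ)).1 x)

lemma lift_derivative (φ : SmoothTorus) :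
    lift (torusDeriv φ).1 = deriv (lift φ.1) :=
  lift_periodicLift (periodic_deriv_lift φ.1)

lemma lift_iterate_derivative (φ : SmoothTorus) (j : ℕ) :
    lift (torusDeriv^[j] φ).1 = iteratedDeriv j (lift φ.1) := by
  induction j with
  | zero => simp
  | succ j ih =>
    rw [Function.iterate_succ_apply', lift_derivative, ih, iteratedDeriv_succ]

lemma derivative_expTest (n : ℤ) :
    torusDeriv (expTest n) = (2 * Real.pi * Complex.I * n : ℂ) • expTest n := by
  ext x
  induction x using QuotientAddGroup.induction_on with | H x => ?_
  have h := congrFun (lift_derivative (expTest n)) x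
  have h2 := (hasDerivAt_fourier 1 n x).deriv
  simp only [Complex.ofReal_one, div_one] at h2
  exact h.trans h2

lemma fourierCoeff_derivative (φ : SmoothTorus) (n : ℤ) :
    fourierCoeff (torusDeriv φ).1 n = (2 * Real.pi * Complex.I * n : ℂ) * fourierCoeff φ.1 n := by
  have key : ∀ ψ : SmoothTorus, fourierCoeff ψ.1 n = fourierCoeffOn zero_lt_one (lift ψ.1) n := by
    intro ψ
    rw [fourierCoeff_eq_intervalIntegral _ _ 0, fourierCoeffOn_eq_integral]
    simp only [zero_add, one_div, inv_one, one_smul, sub_zero]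
    refine intervalIntegral.integral_congr fun x _ => ?_
    simp [lift]
  have hd : ∀ x, HasDerivAt (lift φ.1) (lift (torusDeriv φ).1 x) x := by
    intro x
    rw [lift_derivative]
    exact ((contDiff_infty_iff_deriv.1 (contDiff_lift φ)).1 x).hasDerivAt
  have hper : lift φ.1 1 = lift φ.1 0 := by simpa using lift_periodic φ.1 0
  rw [key, key]
  rcases eq_or_ne n 0 with rfl | hn
  · have h0 := intervalIntegral.integral_eq_sub_of_hasDerivAt (a := 0) (b := 1) (fun x _ => hd x)
      ((contDiff_lift _).continuous.intervalIntegrable _ _)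
    rw [fourierCoeffOn_eq_integral]
    simp [h0, hper]
  · rw [fourierCoeffOn_of_hasDerivAt zero_lt_one hn (fun x _ => hd x)
      ((contDiff_lift _).continuous.intervalIntegrable _ _), hper]
    have hn' : (n : ℂ) ≠ 0 := by exact_mod_cast hn
    have hpi : (Real.pi : ℂ) ≠ 0 := by exact_mod_cast Real.pi_ne_zero
    have hI := Complex.I_ne_zero
    simp only [Complex.ofReal_one, Complex.ofReal_zero]
    field_simp
    ring

lemma norm_fourierCoeff_le (f : C(UnitAddCircle, ℂ)) (n : ℤ) : ‖fourierCoeff f n‖ ≤ ‖f‖ := by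
  rw [fourierCoeff]
  refine (norm_integral_le_of_norm_le_const (C := ‖f‖) (ae_of_all _ fun x => ?_)).trans (by simp)
  rw [norm_smul]
  have : ‖(fourier (-n) x : ℂ)‖ = 1 := by rw [fourier_apply]; exact Circle.norm_coe _
  rw [this, one_mul]
  exact f.norm_coe_le_norm x

lemma summable_fourierCoeff_smooth (φ : SmoothTorus) : Summable (fourierCoeff φ.1) := by
  set M := ‖(toCont (torusDeriv (torusDeriv φ)))‖ with hM
  have hb : ∀ n : ℤ, n ≠ 0 → ‖fourierCoeff φ.1 n‖ ≤ M * (1 / |(n : ℝ)| ^ 2) := by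
    intro n hn
    have h1 := norm_fourierCoeff_le
      (toCont (torusDeriv (torusDeriv φ))) n
    change ‖fourierCoeff (torusDeriv (torusDeriv φ)).1 n‖ ≤ M at h1
    have hn' : 0 < |(n : ℝ)| := by positivity
    rw [fourierCoeff_derivative, fourierCoeff_derivative] at h1
    simp only [norm_mul, Complex.norm_I, Complex.norm_ofNat, Complex.norm_real, mul_one,
      Complex.norm_intCast, Real.norm_eq_abs, abs_of_pos Real.pi_pos] at h1
    rw [mul_one_div, le_div_iff₀ (by positivity)]
    refine le_trans ?_ h1
    have hp := Real.pi_gt_three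
    have : 0 ≤ ‖fourierCoeff φ.1 n‖ := norm_nonneg _
    have h3 : (1 : ℝ) ≤ 2 * Real.pi * (2 * Real.pi) := by nlinarith
    calc ‖fourierCoeff φ.1 n‖ * |(n : ℝ)| ^ 2
        = 1 * (‖fourierCoeff φ.1 n‖ * |(n : ℝ)| ^ 2) := (one_mul _).symm
      _ ≤ (2 * Real.pi * (2 * Real.pi)) * (‖fourierCoeff φ.1 n‖ * |(n : ℝ)| ^ 2) := by gcongr
      _ = _ := by ring
  have hs : Summable (fun n : ℤ => M * (1 / |(n : ℝ)| ^ 2)) := by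
    simp only [sq_abs]
    exact (Real.summable_one_div_int_pow.2 one_lt_two).mul_left M
  refine hs.of_norm_bounded_eventually ?_
  filter_upwards [(Set.finite_singleton (0 : ℤ)).compl_mem_cofinite] with n hn
  exact hb n hn

lemma smoothNorm_le (N : ℕ) (φ : SmoothTorus) :
    smoothNorm N φ ≤ ∑ j ∈ Finset.range (N + 1), ‖(toCont (torusDeriv^[j] φ))‖ := by
  refine Finset.sum_le_sum fun j _ => ?_
  refine Real.iSup_le (fun x => ?_) (norm_nonneg _)
  rw [← lift_iterate_derivative]
  exact (toCont (torusDeriv^[j] φ)).norm_coe_le_norm _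

lemma norm_le_smoothNorm_zero (φ : SmoothTorus) (x : UnitAddCircle) : ‖φ.1 x‖ ≤ smoothNorm 0 φ := by
  induction x using QuotientAddGroup.induction_on with | H x => ?_
  simp only [smoothNorm, zero_add, Finset.range_one, Finset.sum_singleton, iteratedDeriv_zero]
  refine le_ciSup (f := fun x : ℝ => ‖lift φ.1 x‖) ⟨‖(toCont φ)‖, ?_⟩ x
  rintro _ ⟨y, rfl⟩
  exact (toCont φ).norm_coe_le_norm _

/-- The partial Fourier sum of a smooth function, as a smooth function. -/
def fourierPartialSum (φ : SmoothTorus) (s : Finset ℤ) : SmoothTorus :=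
  ∑ n ∈ s, fourierCoeff φ.1 n • expTest n

lemma derivative_fourierPartialSum (φ : SmoothTorus) (s : Finset ℤ) :
    torusDeriv (fourierPartialSum φ s) =
      fourierPartialSum (torusDeriv φ) s := by
  simp only [fourierPartialSum, map_sum, map_smul]
  refine Finset.sum_congr rfl fun n _ => ?_
  rw [fourierCoeff_derivative, derivative_expTest, smul_smul, mul_comm]

lemma tendsto_fourierPartialSum (φ : SmoothTorus) :
    Tendsto (fun s => (toCont (fourierPartialSum φ s))) atTop (𝓝 (toCont φ)) := by
  have h : HasSum (fun i => fourierCoeff (toCont φ) i • fourier i) (toCont φ) :=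
    hasSum_fourier_series_of_summable (summable_fourierCoeff_smooth φ)
  refine Tendsto.congr (fun s => ?_) h
  simp only [fourierPartialSum, map_sum, map_smul]
  rfl

/-- The Fourier series of a smooth function converges in every norm `smoothNorm N`, since
differentiation commutes with taking partial sums. -/
lemma tendsto_smoothNorm_sub_fourierPartialSum (N : ℕ) (φ : SmoothTorus) :
    Tendsto (fun s => smoothNorm N (fourierPartialSum φ s - φ)) atTop (𝓝 0) := by
  have hit : ∀ (j : ℕ) (s : Finset ℤ), torusDeriv^[j] (fourierPartialSum φ s - φ) =
      fourierPartialSum (torusDeriv^[j] φ) s - torusDeriv^[j] φ := by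
    intro j s
    induction j with
    | zero => rfl
    | succ j ih =>
      rw [Function.iterate_succ_apply', Function.iterate_succ_apply', ih, map_sub,
        derivative_fourierPartialSum]
  have h0 : Tendsto (fun s => ∑ j ∈ Finset.range (N + 1),
      ‖(toCont (torusDeriv^[j] (fourierPartialSum φ s - φ)))‖) atTop (𝓝 0) := by
    rw [← Finset.sum_const_zero (s := Finset.range (N + 1))]
    refine tendsto_finsetSum _ fun j _ => ?_
    simp only [hit, map_sub]
    exact tendsto_iff_norm_sub_tendsto_zero.1 (tendsto_fourierPartialSum _)
  refine squeeze_zero (fun s => ?_) (fun s => smoothNorm_le N _) h0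
  exact Finset.sum_nonneg fun j _ => Real.iSup_nonneg fun x => norm_nonneg _

/-! ### Distributions given by functions -/

/-- A distribution is determined by its Fourier coefficients: it may be paired with the Fourier
series of a smooth function term by term. -/
lemma TorusDistribution.hasSum_coeff (u : TorusDistribution) (φ : SmoothTorus) :
    HasSum (fun n : ℤ => fourierCoeff φ.1 n * u.coeff (-n)) (u.toLinearMap φ) := by
  obtain ⟨N, C, hC⟩ := u.continuous'
  have h1 : Tendsto (fun s => u.toLinearMap (fourierPartialSum φ s - φ)) atTop (𝓝 0) := by
    refine squeeze_zero_norm (fun s => hC _) ?_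
    simpa using (tendsto_smoothNorm_sub_fourierPartialSum N φ).const_mul C
  have h2 : Tendsto (fun s => u.toLinearMap (fourierPartialSum φ s)) atTop
      (𝓝 (u.toLinearMap φ)) := by
    simpa using h1.add_const (u.toLinearMap φ)
  refine Tendsto.congr (fun s => ?_) h2
  simp [fourierPartialSum, map_sum, TorusDistribution.coeff]

lemma integrable_mul_smooth {f : UnitAddCircle → ℂ} (hf : Integrable f) (g : C(UnitAddCircle, ℂ)) :
    Integrable (fun x => f x * g x) :=
  hf.mul_bdd (c := ‖g‖) g.continuous.aestronglyMeasurable (ae_of_all _ g.norm_coe_le_norm)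

/-- The distribution defined by an integrable function. -/
def ofFunction (f : UnitAddCircle → ℂ) (hf : Integrable f) : TorusDistribution where
  toLinearMap :=
    { toFun := fun φ => ∫ x, f x * φ.1 x
      map_add' := fun φ ψ => by
        have := integral_add (integrable_mul_smooth hf (toCont φ))
          (integrable_mul_smooth hf (toCont ψ))
        simpa [mul_add] using this
      map_smul' := fun c φ => by
        simp [← integral_const_mul, mul_left_comm] }
  continuous' := by
    refine ⟨0, ∫ x, ‖f x‖, fun φ => ?_⟩
    simp only [LinearMap.coe_mk, AddHom.coe_mk]
    rw [← integral_mul_const]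
    refine norm_integral_le_of_norm_le (hf.norm.mul_const _) (ae_of_all _ fun x => ?_)
    rw [norm_mul]
    gcongr
    exact norm_le_smoothNorm_zero φ x

lemma isFunction_ofFunction {f : UnitAddCircle → ℂ} (hf : Integrable f) :
    (ofFunction f hf).IsFunction f := ⟨hf, fun _ => rfl⟩

lemma TorusDistribution.IsFunction.coeff_eq {u : TorusDistribution} {f : UnitAddCircle → ℂ}
    (h : u.IsFunction f) (n : ℤ) : u.coeff n = fourierCoeff f n := by
  rw [TorusDistribution.coeff, h.2, fourierCoeff, volume_eq_haarAddCircle]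
  refine integral_congr_ae (ae_of_all _ fun x => ?_)
  simp [expTest, mul_comm]

/-- An integrable function represents the distribution that has the same Fourier coefficients. -/
lemma isFunction_of_fourierCoeff_eq {u : TorusDistribution} {f : UnitAddCircle → ℂ}
    (hf : Integrable f) (h : ∀ n, u.coeff n = fourierCoeff f n) : u.IsFunction f := by
  refine ⟨hf, fun φ => ?_⟩
  have h1 := u.hasSum_coeff φ
  have h2 := (ofFunction f hf).hasSum_coeff φ
  refine h1.unique ?_
  simp only [(isFunction_ofFunction hf).coeff_eq, ← h] at h2
  exact h2

/-- An integrable function all of whose Fourier coefficients vanish is zero almost everywhere: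
it is orthogonal to all continuous functions, hence to indicators of closed sets. -/
lemma ae_eq_zero_of_fourierCoeff_eq_zero {f : UnitAddCircle → ℂ} (hf : Integrable f)
    (h : ∀ n, fourierCoeff f n = 0) : f =ᵐ[volume] 0 := by
  have hcont : ∀ g : C(UnitAddCircle, ℂ), ∫ x, f x * g x = 0 := by
    let T : C(UnitAddCircle, ℂ) →ₗ[ℂ] ℂ :=
      { toFun := fun g => ∫ x, f x * g x
        map_add' := fun g k => by
          rw [← integral_add (integrable_mul_smooth hf g) (integrable_mul_smooth hf k)]
          simp [mul_add]
        map_smul' := fun c g => by simp [← integral_const_mul, mul_left_comm] }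
    have hT : Continuous T := by
      refine (T.mkContinuous (∫ x, ‖f x‖) fun g => ?_).continuous
      change ‖∫ x, f x * g x‖ ≤ _
      rw [← integral_mul_const]
      refine norm_integral_le_of_norm_le (hf.norm.mul_const _) (ae_of_all _ fun x => ?_)
      rw [norm_mul]
      gcongr
      exact g.norm_coe_le_norm x
    intro g
    have hker : Submodule.span ℂ (Set.range (fourier (T := (1 : ℝ)))) ≤ LinearMap.ker T := by
      rw [Submodule.span_le]
      rintro _ ⟨n, rfl⟩
      have := h (-n)
      rw [fourierCoeff, ← volume_eq_haarAddCircle, neg_neg] at this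
      change ∫ x, f x * fourier n x = 0
      simpa [mul_comm] using this
    have hclosed : IsClosed (LinearMap.ker T : Set C(UnitAddCircle, ℂ)) :=
      isClosed_singleton.preimage hT
    have := Submodule.topologicalClosure_minimal _ hker hclosed
    rw [span_fourier_closure_eq_top] at this
    exact this (Submodule.mem_top (x := g))
  refine ae_eq_zero_of_forall_setIntegral_isClosed_eq_zero hf fun s hs => ?_
  obtain ⟨δ, -, hδ, hδ0⟩ := exists_seq_strictAnti_tendsto (0 : ℝ)
  have hlim := thickenedIndicator_tendsto_indicator_closure hδ hδ0 s
  rw [hs.closure_eq] at hlim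
  rw [← integral_indicator hs.measurableSet]
  refine tendsto_nhds_unique (f := fun n : ℕ => ∫ x, f x *
    ((thickenedIndicator (hδ n) s x : NNReal) : ℂ)) (l := atTop) ?_ ?_
  · refine tendsto_integral_of_dominated_convergence (fun x => ‖f x‖) (fun n => ?_) hf.norm
      (fun n => ae_of_all _ fun x => ?_) (ae_of_all _ fun x => ?_)
    · refine hf.1.mul (Continuous.aestronglyMeasurable ?_)
      have := (thickenedIndicator (hδ n) s).continuous
      fun_prop
    · rw [norm_mul]
      refine mul_le_of_le_one_right (norm_nonneg _) ?_
      simpa using thickenedIndicator_le_one (hδ n) s x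
    · have h1 := tendsto_pi_nhds.1 hlim x
      have h2 : Tendsto (fun n => ((thickenedIndicator (hδ n) s x : NNReal) : ℂ)) atTop
          (𝓝 (((s.indicator (fun _ => 1) x : NNReal)) : ℂ)) := by
        have hc : Continuous (fun r : NNReal => ((r : ℝ) : ℂ)) := by fun_prop
        exact (hc.tendsto _).comp h1
      have h3 := h2.const_mul (f x)
      convert h3 using 2
      by_cases hx : x ∈ s <;> simp [hx]
  · have : ∀ n : ℕ, ∫ x, f x * ((thickenedIndicator (hδ n) s x : NNReal) : ℂ) = 0 := by
      intro n
      refine hcont ⟨fun x => ((thickenedIndicator (hδ n) s x : NNReal) : ℂ), ?_⟩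
      have := (thickenedIndicator (hδ n) s).continuous
      fun_prop
    simp only [this, tendsto_const_nhds_iff]

lemma TorusDistribution.IsFunction.ae_eq {u : TorusDistribution} {f g : UnitAddCircle → ℂ}
    (hf : u.IsFunction f) (hg : u.IsFunction g) : f =ᵐ[volume] g := by
  have h := ae_eq_zero_of_fourierCoeff_eq_zero (hf.1.sub hg.1) fun n => by
    have h1 := hf.coeff_eq n
    rw [hg.coeff_eq n] at h1
    have h2 := hf.1.sub hg.1
    have hi : ∀ {k : UnitAddCircle → ℂ}, Integrable k →
        Integrable (fun x => fourier (-n) x • k x) := fun hk => by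
      simpa [mul_comm] using integrable_mul_smooth hk (fourier (-n))
    simp only [fourierCoeff, ← volume_eq_haarAddCircle] at h1 ⊢
    simp only [Pi.sub_apply, smul_sub]
    rw [integral_sub (hi hf.1) (hi hg.1), h1, sub_self]
  filter_upwards [h] with x hx
  exact sub_eq_zero.1 hx

/-! ### Sub-Gaussian bounds for lacunary sums -/

/-- The trigonometric polynomials with frequencies in `S`. -/
def trigSpan (S : Set ℤ) : Submodule ℂ C(UnitAddCircle, ℂ) :=
  Submodule.span ℂ (fourier (T := (1 : ℝ)) '' S)

lemma trigSpan_mono {S T : Set ℤ} (h : S ⊆ T) : trigSpan S ≤ trigSpan T :=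
  Submodule.span_mono (Set.image_mono h)

lemma fourier_mem_trigSpan {S : Set ℤ} {n : ℤ} (h : n ∈ S) : fourier n ∈ trigSpan S :=
  Submodule.subset_span ⟨n, h, rfl⟩

lemma mul_mem_trigSpan {S T U : Set ℤ} {f g : C(UnitAddCircle, ℂ)} (hf : f ∈ trigSpan S)
    (hg : g ∈ trigSpan T) (hU : ∀ m ∈ S, ∀ n ∈ T, m + n ∈ U) : f * g ∈ trigSpan U := by
  have h := Submodule.mul_mem_mul hf hg
  rw [trigSpan, trigSpan, Submodule.span_mul_span] at h
  refine Submodule.span_mono ?_ h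
  rintro _ ⟨_, ⟨m, hm, rfl⟩, _, ⟨n, hn, rfl⟩, rfl⟩
  refine ⟨m + n, hU m hm n hn, ?_⟩
  ext x
  simp

lemma star_mem_trigSpan {S : Set ℤ} (hS : ∀ n ∈ S, -n ∈ S) {f : C(UnitAddCircle, ℂ)}
    (hf : f ∈ trigSpan S) : star f ∈ trigSpan S := by
  induction hf using Submodule.span_induction with
  | mem _ h =>
    obtain ⟨n, hn, rfl⟩ := h
    convert fourier_mem_trigSpan (hS n hn) using 1
    ext x
    simp
  | zero => simp
  | add f g _ _ hf hg => rw [star_add]; exact add_mem hf hg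
  | smul c f _ hf => rw [star_smul]; exact Submodule.smul_mem _ _ hf

lemma integral_eq_zero_of_mem_trigSpan {S : Set ℤ} (hS : (0 : ℤ) ∉ S) {f : C(UnitAddCircle, ℂ)}
    (hf : f ∈ trigSpan S) : ∫ x, f x = 0 := by
  induction hf using Submodule.span_induction with
  | mem _ h =>
    obtain ⟨n, hn, rfl⟩ := h
    have h := congrFun (fourierCoeff_fourier (T := 1) n) 0
    rw [Pi.single_eq_of_ne (by rintro rfl; exact hS hn), fourierCoeff,
      ← volume_eq_haarAddCircle] at h
    simpa using h
  | zero => simp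
  | add f g _ _ hf hg =>
    have := integral_add (integrable_continuousMap f) (integrable_continuousMap g)
    simpa [hf, hg] using this
  | smul c f _ hf =>
    have := integral_const_mul (μ := (volume : Measure UnitAddCircle)) c f
    simpa [hf] using this

/-- The real part of a continuous function, again as a complex function. -/
def realPartMap (f : C(UnitAddCircle, ℂ)) : C(UnitAddCircle, ℂ) := (1 / 2 : ℂ) • (f + star f)

lemma realPartMap_apply (f : C(UnitAddCircle, ℂ)) (x : UnitAddCircle) :
    realPartMap f x = ((f x).re : ℂ) := by
  rw [Complex.re_eq_add_conj]
  simp [realPartMap]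
  ring

/-- Riesz products: if the frequencies of `g j` exceed all sums of frequencies of the
earlier factors, then the constant coefficient of the product is the product of the constants. -/
lemma integral_rieszProduct {g : ℕ → C(UnitAddCircle, ℂ)} {m M : ℕ → ℕ}
    (hg : ∀ j, g j ∈ trigSpan {n : ℤ | m j ≤ n.natAbs ∧ n.natAbs ≤ M j})
    (hmM : ∀ j, ∑ i ∈ Finset.range j, M i < m j) (c s : ℕ → ℂ) (N : ℕ) :
    (∏ j ∈ Finset.range N, (c j • 1 + s j • g j)) ∈
        trigSpan {n : ℤ | n.natAbs ≤ ∑ i ∈ Finset.range N, M i} ∧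
      ∫ x, (∏ j ∈ Finset.range N, (c j • 1 + s j • g j)) x = ∏ j ∈ Finset.range N, c j := by
  have hone : (1 : C(UnitAddCircle, ℂ)) = fourier 0 := by
    ext x; simp
  induction N with
  | zero =>
    refine ⟨?_, by simp [measureReal_def]⟩
    simp only [Finset.range_zero, Finset.prod_empty, hone]
    exact fourier_mem_trigSpan (by simp)
  | succ N ih =>
    obtain ⟨ih1, ih2⟩ := ih
    rw [Finset.prod_range_succ, Finset.prod_range_succ, Finset.sum_range_succ]
    set P := ∏ j ∈ Finset.range N, (c j • 1 + s j • g j) with hP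
    have hsplit : P * (c N • 1 + s N • g N) = c N • P + s N • (P * g N) := by
      rw [mul_add, mul_smul_comm, mul_smul_comm, mul_one]
    have hPg : P * g N ∈ trigSpan {n : ℤ | n ≠ 0 ∧ n.natAbs ≤ ∑ i ∈ Finset.range N, M i + M N} := by
      refine mul_mem_trigSpan ih1 (hg N) ?_
      intro a ha b hb
      have := hmM N
      simp only [Set.mem_ofPred_eq] at ha hb ⊢
      omega
    constructor
    · rw [hsplit]
      refine add_mem (Submodule.smul_mem _ _ (trigSpan_mono ?_ ih1))
        (Submodule.smul_mem _ _ (trigSpan_mono ?_ hPg))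
      · intro a ha
        simp only [Set.mem_ofPred_eq] at ha ⊢
        omega
      · intro a ha
        exact ha.2
    · have h0 : ∫ x, (P * g N) x = 0 := integral_eq_zero_of_mem_trigSpan (by simp) hPg
      have h1 := integral_add ((integrable_continuousMap P).const_mul (c N))
        ((integrable_continuousMap (P * g N)).const_mul (s N))
      rw [integral_const_mul, integral_const_mul, h0, ih2, mul_zero, add_zero,
        mul_comm (c N)] at h1
      rw [hsplit, ← h1]
      rfl

/-- The exponential moment of a lacunary sum. On `[-a, a]` the convex function `exp (lam * y)` lies
below its chord `cosh (lam * a) + (y / a) * sinh (lam * a)`, so that the exponential of the sum is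
dominated by a Riesz product. -/
lemma hasSubgaussianMGF_lacunary {g : ℕ → C(UnitAddCircle, ℂ)} {m M : ℕ → ℕ}
    (hg : ∀ j, g j ∈ trigSpan {n : ℤ | m j ≤ n.natAbs ∧ n.natAbs ≤ M j})
    (hmM : ∀ j, ∑ i ∈ Finset.range j, M i < m j) {a : ℕ → ℝ} (ha : ∀ j x, ‖g j x‖ ≤ a j)
    {σ : NNReal} {N : ℕ} (hσ : ∑ j ∈ Finset.range N, a j ^ 2 ≤ σ) :
    ProbabilityTheory.HasSubgaussianMGF
      (fun x => ∑ j ∈ Finset.range N, (g j x).re) σ (volume : Measure UnitAddCircle) := by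
  have hcont : Continuous (fun x => ∑ j ∈ Finset.range N, (g j x).re) :=
    continuous_finsetSum _ fun j _ => Complex.continuous_re.comp (g j).continuous
  refine ⟨fun lam => ?_, fun lam => ?_⟩
  · exact (Continuous.integrable_of_hasCompactSupport (by fun_prop)
      (HasCompactSupport.of_compactSpace _))
  have hr : ∀ j, realPartMap (g j) ∈ trigSpan {n : ℤ | m j ≤ n.natAbs ∧ n.natAbs ≤ M j} := by
    intro j
    refine Submodule.smul_mem _ _ (add_mem (hg j) (star_mem_trigSpan ?_ (hg j)))
    intro n hn
    simpa using hn
  have ha0 : ∀ j, 0 ≤ a j := fun j => (norm_nonneg _).trans (ha j 0)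
  have hri := (integral_rieszProduct hr hmM (fun j => (Real.cosh (lam * a j) : ℂ))
    (fun j => (Real.sinh (lam * a j) / a j : ℝ)) N).2
  have hri' : ∫ x : UnitAddCircle, ∏ j ∈ Finset.range N,
      (Real.cosh (lam * a j) + (g j x).re / a j * Real.sinh (lam * a j)) =
      ∏ j ∈ Finset.range N, Real.cosh (lam * a j) := by
    have : ((∫ x : UnitAddCircle, ∏ j ∈ Finset.range N,
      (Real.cosh (lam * a j) + (g j x).re / a j * Real.sinh (lam * a j)) : ℝ) : ℂ) =
      ((∏ j ∈ Finset.range N, Real.cosh (lam * a j) : ℝ) : ℂ) := by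
      rw [← integral_complex_ofReal, Complex.ofReal_prod, ← hri]
      refine integral_congr_ae (ae_of_all _ fun x => ?_)
      simp only [Complex.ofReal_prod, ContinuousMap.coe_prod, Finset.prod_apply,
        ContinuousMap.coe_add, ContinuousMap.coe_smul, ContinuousMap.coe_one, Pi.add_apply,
        Pi.smul_apply, Pi.one_apply, smul_eq_mul, mul_one, realPartMap_apply]
      refine Finset.prod_congr rfl fun j _ => ?_
      push_cast
      ring
    exact_mod_cast this
  calc ProbabilityTheory.mgf (fun x => ∑ j ∈ Finset.range N, (g j x).re) volume lam
      ≤ ∫ x : UnitAddCircle, ∏ j ∈ Finset.range N,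
        (Real.cosh (lam * a j) + (g j x).re / a j * Real.sinh (lam * a j)) := by
        refine integral_mono
          (Continuous.integrable_of_hasCompactSupport (by fun_prop)
            (HasCompactSupport.of_compactSpace _))
          (Continuous.integrable_of_hasCompactSupport ?_ (HasCompactSupport.of_compactSpace _))
          fun x => ?_
        · refine continuous_finsetProd _ fun j _ => ?_
          have := Complex.continuous_re.comp (g j).continuous
          simp only [Function.comp_def] at this
          fun_prop
        · change Real.exp _ ≤ _
          rw [Finset.mul_sum, Real.exp_sum]
          refine Finset.prod_le_prod (fun _ _ => (Real.exp_pos _).le) fun j _ => ?_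
          have hle : |(g j x).re| ≤ a j := (Complex.abs_re_le_norm _).trans (ha j x)
          rcases (ha0 j).eq_or_lt with h | h
          · have h0 : (g j x).re = 0 := by rw [← h] at hle; exact abs_nonpos_iff.1 hle
            simp [h0, ← h]
          · have := Real.exp_mul_le_cosh_add_mul_sinh (t := (g j x).re / a j)
              (by rw [abs_div, abs_of_pos h]; exact (div_le_one h).2 hle) (lam * a j)
            refine le_trans (le_of_eq ?_) this
            congr 1
            field_simp
    _ = ∏ j ∈ Finset.range N, Real.cosh (lam * a j) := hri'
    _ ≤ ∏ j ∈ Finset.range N, Real.exp ((lam * a j) ^ 2 / 2) :=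
        Finset.prod_le_prod (fun _ _ => (Real.cosh_pos _).le)
          fun j _ => Real.cosh_le_exp_half_sq _
    _ = Real.exp ((∑ j ∈ Finset.range N, a j ^ 2) * lam ^ 2 / 2) := by
        rw [← Real.exp_sum, Finset.sum_mul, Finset.sum_div]
        congr 1
        exact Finset.sum_congr rfl fun j _ => by ring
    _ ≤ Real.exp (σ * lam ^ 2 / 2) := by gcongr

/-- A complex number of modulus greater than `2 s` has one of the four coordinates
`± Re`, `± Im` at least `s`. -/
lemma exists_le_re_of_lt_norm {z : ℂ} {s : ℝ} (h : 2 * s < ‖z‖) :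
    s ≤ z.re ∨ s ≤ (-1 * z).re ∨ s ≤ (Complex.I * z).re ∨ s ≤ (-Complex.I * z).re := by
  by_contra! hcon
  obtain ⟨h1, h2, h3, h4⟩ := hcon
  simp at h2 h3 h4
  have := Complex.norm_le_abs_re_add_abs_im z
  have h5 : |z.re| ≤ s := abs_le.2 ⟨by linarith, by linarith⟩
  have h6 : |z.im| ≤ s := abs_le.2 ⟨by linarith, by linarith⟩
  linarith

/-- The Gaussian tail of a lacunary sum of complex-valued functions. The Chernoff bound is applied
to the real parts of the sum multiplied by `1`, `-1`, `I` and `-I`. -/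
lemma measure_lacunary_gt_le {g : ℕ → C(UnitAddCircle, ℂ)} {m M : ℕ → ℕ}
    (hg : ∀ j, g j ∈ trigSpan {n : ℤ | m j ≤ n.natAbs ∧ n.natAbs ≤ M j})
    (hmM : ∀ j, ∑ i ∈ Finset.range j, M i < m j) {a : ℕ → ℝ} (ha : ∀ j x, ‖g j x‖ ≤ a j)
    {σ : NNReal} {N : ℕ} (hσ : ∑ j ∈ Finset.range N, a j ^ 2 ≤ σ) {s : ℝ} (hs : 0 ≤ s) :
    volume {x : UnitAddCircle | 2 * s < ‖∑ j ∈ Finset.range N, g j x‖} ≤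
      4 * ENNReal.ofReal (Real.exp (-s ^ 2 / (2 * σ))) := by
  have hc : ∀ c : ℂ, ‖c‖ = 1 →
      volume {x : UnitAddCircle | s ≤ (c * ∑ j ∈ Finset.range N, g j x).re} ≤
      ENNReal.ofReal (Real.exp (-s ^ 2 / (2 * σ))) := by
    intro c hc
    have h := (hasSubgaussianMGF_lacunary (g := fun j => c • g j)
      (fun j => Submodule.smul_mem _ _ (hg j)) hmM (a := a) (fun j x => by simpa [hc] using ha j x)
      hσ).measure_ge_le hs
    rw [← ofReal_measureReal]
    refine ENNReal.ofReal_le_ofReal (le_trans (le_of_eq ?_) h)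
    simp [Finset.mul_sum]
  calc volume {x : UnitAddCircle | 2 * s < ‖∑ j ∈ Finset.range N, g j x‖}
      ≤ volume ({x : UnitAddCircle | s ≤ (1 * ∑ j ∈ Finset.range N, g j x).re} ∪
          ({x : UnitAddCircle | s ≤ (-1 * ∑ j ∈ Finset.range N, g j x).re} ∪
          ({x : UnitAddCircle | s ≤ (Complex.I * ∑ j ∈ Finset.range N, g j x).re} ∪
          {x : UnitAddCircle | s ≤ (-Complex.I * ∑ j ∈ Finset.range N, g j x).re}))) := by
        refine measure_mono fun x hx => ?_
        change s ≤ (1 * _ : ℂ).re ∨ _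
        rw [one_mul]
        exact exists_le_re_of_lt_norm hx
    _ ≤ ENNReal.ofReal (Real.exp (-s ^ 2 / (2 * σ))) +
        (ENNReal.ofReal (Real.exp (-s ^ 2 / (2 * σ))) +
        (ENNReal.ofReal (Real.exp (-s ^ 2 / (2 * σ))) +
          ENNReal.ofReal (Real.exp (-s ^ 2 / (2 * σ))))) := by
        refine (measure_union_le _ _).trans (add_le_add (hc _ (by simp)) ?_)
        refine (measure_union_le _ _).trans (add_le_add (hc _ (by simp)) ?_)
        exact (measure_union_le _ _).trans (add_le_add (hc _ (by simp)) (hc _ (by simp)))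
    _ = 4 * ENNReal.ofReal (Real.exp (-s ^ 2 / (2 * σ))) := by ring

/-! ### Littlewood–Paley pieces -/

lemma IsCutoff.eq_zero {Φ : ℝ → ℂ} (hΦ : IsCutoff Φ) {s : ℝ} (hs : 2 ≤ |s|) : Φ s = 0 := by
  by_contra h
  have := hΦ.support h
  rw [Set.mem_Ioo, ← abs_lt] at this
  linarith

lemma dyadicCutoff_eq_zero_of_le {Φ : ℝ → ℂ} (hΦ : IsCutoff Φ) (k : ℕ) {s : ℝ}
    (hs : 2 ^ (k + 1) ≤ |s|) : dyadicCutoff Φ k s = 0 := by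
  cases k with
  | zero => exact hΦ.eq_zero (by simpa using hs)
  | succ k =>
    have h1 : 2 ≤ |s / 2 ^ (k + 1)| := by
      rw [abs_div, abs_of_pos (by positivity : (0 : ℝ) < 2 ^ (k + 1)), le_div_iff₀ (by positivity)]
      exact le_trans (le_of_eq (by ring)) hs
    have h2 : 2 ≤ |s / 2 ^ k| := by
      rw [abs_div, abs_of_pos (by positivity : (0 : ℝ) < 2 ^ k), le_div_iff₀ (by positivity)]
      refine le_trans ?_ hs
      rw [pow_succ, pow_succ]
      have : (0 : ℝ) < 2 ^ k := by positivity
      linarith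
    simp [dyadicCutoff, hΦ.eq_zero h1, hΦ.eq_zero h2]

lemma IsCutoff.div_eq_one {Φ : ℝ → ℂ} (hΦ : IsCutoff Φ) {k : ℕ} {s : ℝ} (hs : |s| ≤ 2 ^ k) :
    Φ (s / 2 ^ k) = 1 := by
  refine hΦ.eq_one _ ?_
  rwa [abs_div, abs_of_pos (by positivity : (0 : ℝ) < 2 ^ k), div_le_one (by positivity)]

lemma dyadicCutoff_succ_eq_zero_of_le {Φ : ℝ → ℂ} (hΦ : IsCutoff Φ) (k : ℕ) {s : ℝ}
    (hs : |s| ≤ 2 ^ k) : dyadicCutoff Φ (k + 1) s = 0 := by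
  have h : |s| ≤ 2 ^ (k + 1) := hs.trans (pow_le_pow_right₀ one_le_two (Nat.le_succ k))
  simp [dyadicCutoff, hΦ.div_eq_one hs, hΦ.div_eq_one h]

/-- The sum defining the dyadic partition of unity telescopes. -/
lemma sum_dyadicCutoff (Φ : ℝ → ℂ) (K : ℕ) (s : ℝ) :
    ∑ k ∈ Finset.range (K + 1), dyadicCutoff Φ k s = Φ (s / 2 ^ K) := by
  induction K with
  | zero => simp [dyadicCutoff]
  | succ K ih => rw [Finset.sum_range_succ, ih]; simp [dyadicCutoff]

lemma exists_dyadicCutoff_add_eq_one {Φ : ℝ → ℂ} (hΦ : IsCutoff Φ) (s : ℝ) :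
    ∃ k, dyadicCutoff Φ k s + dyadicCutoff Φ (k + 1) s = 1 := by
  have hex : ∃ k : ℕ, |s| ≤ 2 ^ k := by
    obtain ⟨k, hk⟩ := pow_unbounded_of_one_lt |s| one_lt_two
    exact ⟨k, hk.le⟩
  obtain ⟨k, hk, hmin⟩ : ∃ k : ℕ, |s| ≤ 2 ^ k ∧ ∀ j < k, ¬ |s| ≤ 2 ^ j :=
    ⟨Nat.find hex, Nat.find_spec hex, fun _ hj => Nat.find_min hex hj⟩
  match k with
  | 0 =>
    refine ⟨0, ?_⟩
    rw [dyadicCutoff_succ_eq_zero_of_le hΦ 0 hk, add_zero]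
    exact hΦ.eq_one _ (by simpa using hk)
  | 1 =>
    refine ⟨0, ?_⟩
    have h := sum_dyadicCutoff Φ 1 s
    rw [hΦ.div_eq_one hk] at h
    simpa [Finset.sum_range_succ] using h
  | k + 2 =>
    refine ⟨k + 1, ?_⟩
    have h := sum_dyadicCutoff Φ (k + 2) s
    have h' := sum_dyadicCutoff Φ k s
    rw [hΦ.div_eq_one hk, Finset.sum_range_succ, Finset.sum_range_succ, h'] at h
    have h0 : Φ (s / 2 ^ k) = 0 := by
      refine hΦ.eq_zero ?_
      rw [abs_div, abs_of_pos (by positivity : (0 : ℝ) < 2 ^ k), le_div_iff₀ (by positivity)]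
      have := not_le.1 (hmin (k + 1) (by omega))
      rw [pow_succ] at this
      linarith
    simpa [h0] using h

/-- The function `L_k u` as a continuous function on the torus. -/
def lpBlock (Φ : ℝ → ℂ) (k : ℕ) (u : TorusDistribution) : C(UnitAddCircle, ℂ) :=
  ∑ n ∈ Finset.Icc (-2 ^ (k + 1) : ℤ) (2 ^ (k + 1)),
    (dyadicCutoff Φ k (n : ℝ) * u.coeff n) • fourier n

lemma dyadicCutoff_eq_zero_of_notMem {Φ : ℝ → ℂ} (hΦ : IsCutoff Φ) {k : ℕ} {n : ℤ}
    (hn : n ∉ Finset.Icc (-2 ^ (k + 1) : ℤ) (2 ^ (k + 1))) : dyadicCutoff Φ k (n : ℝ) = 0 := by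
  refine dyadicCutoff_eq_zero_of_le hΦ k ?_
  rw [Finset.mem_Icc, ← abs_le, not_le] at hn
  exact_mod_cast hn.le

lemma littlewoodPaley_eq_lpBlock {Φ : ℝ → ℂ} (hΦ : IsCutoff Φ) (k : ℕ) (u : TorusDistribution)
    (x : UnitAddCircle) : littlewoodPaley Φ k u x = lpBlock Φ k u x := by
  rw [littlewoodPaley, tsum_eq_sum (s := Finset.Icc (-2 ^ (k + 1) : ℤ) (2 ^ (k + 1)))]
  · simp [lpBlock]
  · intro n hn
    rw [dyadicCutoff_eq_zero_of_notMem hΦ hn, zero_mul, zero_mul]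

/-- The block of index `k + 1` has frequencies of modulus between `2 ^ k` and `2 ^ (k + 2)`. -/
lemma lpBlock_succ_mem_trigSpan {Φ : ℝ → ℂ} (hΦ : IsCutoff Φ) (k : ℕ) (u : TorusDistribution) :
    lpBlock Φ (k + 1) u ∈ trigSpan {n : ℤ | 2 ^ k ≤ n.natAbs ∧ n.natAbs ≤ 2 ^ (k + 2)} := by
  refine Submodule.sum_mem _ fun n hn => ?_
  by_cases h : 2 ^ k ≤ n.natAbs
  · refine Submodule.smul_mem _ _ (fourier_mem_trigSpan ⟨h, ?_⟩)
    rw [Finset.mem_Icc, ← abs_le] at hn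
    zify
    exact hn
  · have h' : |(n : ℝ)| ≤ 2 ^ k := by
      rw [not_le] at h
      zify at h
      exact_mod_cast h.le
    rw [dyadicCutoff_succ_eq_zero_of_le hΦ k h', zero_mul]
    convert Submodule.zero_mem _ using 1
    ext x
    simp

lemma fourierCoeff_lpBlock {Φ : ℝ → ℂ} (hΦ : IsCutoff Φ) (k : ℕ) (u : TorusDistribution) (n : ℤ) :
    fourierCoeff (lpBlock Φ k u) n = dyadicCutoff Φ k (n : ℝ) * u.coeff n := by
  have h := fourierCoeff.sum (T := 1) (Finset.Icc (-2 ^ (k + 1) : ℤ) (2 ^ (k + 1)))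
    (fun m => (((dyadicCutoff Φ k (m : ℝ) * u.coeff m) • fourier m : C(UnitAddCircle, ℂ)) :
      UnitAddCircle → ℂ)) (fun m _ => by
      rw [← volume_eq_haarAddCircle]; exact integrable_continuousMap _)
  have h2 : ((lpBlock Φ k u : C(UnitAddCircle, ℂ)) : UnitAddCircle → ℂ) =
      ∑ m ∈ Finset.Icc (-2 ^ (k + 1) : ℤ) (2 ^ (k + 1)),
      (((dyadicCutoff Φ k (m : ℝ) * u.coeff m) • fourier m : C(UnitAddCircle, ℂ)) :
      UnitAddCircle → ℂ) := by
    simp [lpBlock]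
  rw [h2, h]
  simp only [Finset.sum_apply, ContinuousMap.coe_smul]
  have h3 : ∀ m : ℤ, fourierCoeff ((dyadicCutoff Φ k (m : ℝ) * u.coeff m) •
      (fourier m : UnitAddCircle → ℂ)) n =
      (dyadicCutoff Φ k (m : ℝ) * u.coeff m) * (Pi.single m 1 : ℤ → ℂ) n := by
    intro m
    rw [fourierCoeff.const_smul, fourierCoeff_fourier, smul_eq_mul]
  simp only [h3]
  by_cases hn : n ∈ Finset.Icc (-2 ^ (k + 1) : ℤ) (2 ^ (k + 1))
  · rw [Finset.sum_eq_single_of_mem n hn]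
    · simp
    · intro m _ hm
      rw [Pi.single_eq_of_ne hm.symm, mul_zero]
  · rw [dyadicCutoff_eq_zero_of_notMem hΦ hn, zero_mul]
    refine Finset.sum_eq_zero fun m hm => ?_
    rw [Pi.single_eq_of_ne (by rintro rfl; exact hn hm), mul_zero]

lemma besovNorm_eq {Φ : ℝ → ℂ} (hΦ : IsCutoff Φ) (q : ℝ) (u : TorusDistribution) :
    besovNorm Φ q u = (∑' k : ℕ, ‖lpBlock Φ k u‖ₑ ^ q) ^ (1 / q) := by
  have h : ∀ k, (⨆ x : UnitAddCircle, ‖littlewoodPaley Φ k u x‖ₑ) = ‖lpBlock Φ k u‖ₑ := by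
    intro k
    simp only [littlewoodPaley_eq_lpBlock hΦ]
    refine le_antisymm (iSup_le fun x => ?_) ?_
    · exact enorm_le_iff_norm_le.2 ((lpBlock Φ k u).norm_coe_le_norm x)
    · have hfin : (⨆ x : UnitAddCircle, ‖lpBlock Φ k u x‖ₑ) ≠ ⊤ := by
        refine ne_top_of_le_ne_top (enorm_ne_top (x := lpBlock Φ k u)) (iSup_le fun x => ?_)
        exact enorm_le_iff_norm_le.2 ((lpBlock Φ k u).norm_coe_le_norm x)
      rw [← ofReal_norm, ENNReal.ofReal_le_iff_le_toReal hfin,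
        ContinuousMap.norm_le _ ENNReal.toReal_nonneg]
      intro x
      rw [← ENNReal.ofReal_le_iff_le_toReal hfin, ofReal_norm]
      exact le_iSup (fun x => ‖lpBlock Φ k u x‖ₑ) x
  simp only [besovNorm, h]

lemma summable_norm_lpBlock_rpow {Φ : ℝ → ℂ} (hΦ : IsCutoff Φ) {q : ℝ} (hq : 0 < q)
    {u : TorusDistribution} (hu : u ∈ besovSpace Φ q) :
    Summable (fun k => ‖lpBlock Φ k u‖ ^ q) := by
  change besovNorm Φ q u < ⊤ at hu
  rw [besovNorm_eq hΦ, ENNReal.rpow_lt_top_iff_of_pos (by positivity)] at hu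
  have h := ENNReal.summable_toReal hu.ne
  simpa [← ENNReal.toReal_rpow] using h

lemma sum_norm_lpBlock_rpow_le_one {Φ : ℝ → ℂ} (hΦ : IsCutoff Φ) {q : ℝ} (hq : 0 < q)
    {u : TorusDistribution} (hu : besovNorm Φ q u ≤ 1) (s : Finset ℕ) :
    ∑ k ∈ s, ‖lpBlock Φ k u‖ ^ q ≤ 1 := by
  rw [besovNorm_eq hΦ] at hu
  have hu' : ∑' k, ‖lpBlock Φ k u‖ₑ ^ q ≤ 1 := by
    by_contra! h
    exact absurd hu (not_le.2 (ENNReal.one_lt_rpow h (by positivity)))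
  have h := (ENNReal.sum_le_tsum s).trans hu'
  have h2 := ENNReal.toReal_mono ENNReal.one_ne_top h
  rw [ENNReal.toReal_sum fun k _ => ENNReal.rpow_ne_top_of_nonneg hq.le enorm_ne_top] at h2
  simpa [← ENNReal.toReal_rpow] using h2

/-! ### Square summability and convergence of the Littlewood–Paley series -/

lemma hasSum_sq_norm_fourierCoeff (f : Lp ℂ 2 (AddCircle.haarAddCircle (T := (1 : ℝ)))) :
    HasSum (fun n => ‖fourierCoeff f n‖ ^ 2) (‖f‖ ^ 2) := by
  simp_rw [← fourierBasis_repr]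
  have h : HasSum (fun n => ‖fourierBasis.repr f n‖ ^ 2) (‖fourierBasis.repr f‖ ^ 2) := by
    apply_mod_cast lp.hasSum_norm ?_ (fourierBasis.repr f)
    simp
  simpa using h

lemma sum_sq_norm_fourierCoeff_le (g : C(UnitAddCircle, ℂ)) (s : Finset ℤ) :
    ∑ n ∈ s, ‖fourierCoeff g n‖ ^ 2 ≤ ‖g‖ ^ 2 := by
  set G := ContinuousMap.toLp (E := ℂ) 2 (AddCircle.haarAddCircle (T := (1 : ℝ))) ℂ g with hG
  have h := sum_le_hasSum s (fun _ _ => by positivity) (hasSum_sq_norm_fourierCoeff G)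
  simp only [hG, fourierCoeff_toLp] at h
  refine h.trans ?_
  gcongr
  refine (ContinuousLinearMap.le_of_opNorm_le _ (ContinuousMap.toLp_norm_le _) g).trans ?_
  simp [measureUnivNNReal]

/-- Every frequency is seen by at most two neighbouring blocks, so that the Littlewood–Paley blocks
control the Fourier coefficients in `ℓ²`. -/
lemma summable_sq_coeff {Φ : ℝ → ℂ} (hΦ : IsCutoff Φ) {u : TorusDistribution}
    (hu : Summable (fun k => ‖lpBlock Φ k u‖ ^ 2)) : Summable (fun n => ‖u.coeff n‖ ^ 2) := by
  choose κ hκ using fun n : ℤ => exists_dyadicCutoff_add_eq_one hΦ (n : ℝ)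
  refine summable_of_sum_le (c := 2 * ∑' k, ‖lpBlock Φ k u‖ ^ 2) (fun _ => by positivity)
    fun s => ?_
  set K := s.sup κ + 2 with hK
  have h1 : ∀ n ∈ s, ‖u.coeff n‖ ^ 2 ≤
      2 * ∑ k ∈ Finset.range K, ‖fourierCoeff (lpBlock Φ k u) n‖ ^ 2 := by
    intro n hn
    have hle : κ n ≤ s.sup κ := Finset.le_sup hn
    have hsub : ({κ n, κ n + 1} : Finset ℕ) ⊆ Finset.range K := by
      intro i hi
      simp only [Finset.mem_insert, Finset.mem_singleton] at hi
      rw [Finset.mem_range]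
      omega
    have h2 := Finset.sum_le_sum_of_subset_of_nonneg hsub
      (f := fun k => ‖fourierCoeff (lpBlock Φ k u) n‖ ^ 2) (fun _ _ _ => by positivity)
    rw [Finset.sum_pair (by omega)] at h2
    have h3 : u.coeff n = fourierCoeff (lpBlock Φ (κ n) u) n +
        fourierCoeff (lpBlock Φ (κ n + 1) u) n := by
      rw [fourierCoeff_lpBlock hΦ, fourierCoeff_lpBlock hΦ, ← add_mul, hκ, one_mul]
    have h4 : ‖u.coeff n‖ ^ 2 ≤ (‖fourierCoeff (lpBlock Φ (κ n) u) n‖ +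
        ‖fourierCoeff (lpBlock Φ (κ n + 1) u) n‖) ^ 2 := by
      gcongr
      rw [h3]
      exact norm_add_le _ _
    have h5 := add_sq_le (a := ‖fourierCoeff (lpBlock Φ (κ n) u) n‖)
      (b := ‖fourierCoeff (lpBlock Φ (κ n + 1) u) n‖)
    linarith
  calc ∑ n ∈ s, ‖u.coeff n‖ ^ 2
      ≤ ∑ n ∈ s, 2 * ∑ k ∈ Finset.range K, ‖fourierCoeff (lpBlock Φ k u) n‖ ^ 2 :=
        Finset.sum_le_sum h1
    _ = 2 * ∑ k ∈ Finset.range K, ∑ n ∈ s, ‖fourierCoeff (lpBlock Φ k u) n‖ ^ 2 := by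
        rw [← Finset.mul_sum, Finset.sum_comm]
    _ ≤ 2 * ∑ k ∈ Finset.range K, ‖lpBlock Φ k u‖ ^ 2 := by
        gcongr with k hk
        exact sum_sq_norm_fourierCoeff_le _ _
    _ ≤ 2 * ∑' k, ‖lpBlock Φ k u‖ ^ 2 := by
        gcongr
        exact hu.sum_le_tsum _ fun _ _ => by positivity

lemma fourierCoeff_sum_lpBlock {Φ : ℝ → ℂ} (hΦ : IsCutoff Φ) (K : ℕ) (u : TorusDistribution)
    (n : ℤ) : fourierCoeff (∑ k ∈ Finset.range (K + 1), lpBlock Φ k u : C(UnitAddCircle, ℂ)) n =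
      Φ (n / 2 ^ K) * u.coeff n := by
  have h := fourierCoeff.sum (T := 1) (Finset.range (K + 1))
    (fun k => (lpBlock Φ k u : UnitAddCircle → ℂ)) (fun m _ => by
      rw [← volume_eq_haarAddCircle]; exact integrable_continuousMap _)
  rw [ContinuousMap.coe_sum, h, Finset.sum_apply]
  simp only [fourierCoeff_lpBlock hΦ]
  rw [← Finset.sum_mul, sum_dyadicCutoff]

lemma IsCutoff.tendsto_div {Φ : ℝ → ℂ} (hΦ : IsCutoff Φ) (s : ℝ) :
    Tendsto (fun K : ℕ => Φ (s / 2 ^ K)) atTop (𝓝 1) := by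
  obtain ⟨k, hk⟩ := pow_unbounded_of_one_lt |s| one_lt_two
  refine tendsto_const_nhds.congr' ?_
  filter_upwards [eventually_ge_atTop k] with K hK
  exact (hΦ.div_eq_one (hk.le.trans (pow_le_pow_right₀ one_le_two hK))).symm

lemma IsCutoff.exists_bound {Φ : ℝ → ℂ} (hΦ : IsCutoff Φ) : ∃ C, ∀ s, ‖Φ s‖ ≤ C := by
  obtain ⟨C, hC⟩ := isCompact_Icc.exists_bound_of_continuousOn (s := Set.Icc (-2 : ℝ) 2)
    hΦ.smooth.continuous.continuousOn
  refine ⟨max C 0, fun s => ?_⟩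
  by_cases h : |s| ≤ 2
  · exact (hC s (abs_le.1 h)).trans (le_max_left _ _)
  · rw [hΦ.eq_zero (not_le.1 h).le, norm_zero]
    exact le_max_right _ _

/-- Smooth truncation of the Fourier series converges in `L²`. -/
lemma tendsto_of_fourierCoeff_sub {Φ : ℝ → ℂ} (hΦ : IsCutoff Φ) {a : ℤ → ℂ}
    (ha : Summable (fun n => ‖a n‖ ^ 2))
    {T : ℕ → Lp ℂ 2 (AddCircle.haarAddCircle (T := (1 : ℝ)))}
    {F : Lp ℂ 2 (AddCircle.haarAddCircle (T := (1 : ℝ)))}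
    (hT : ∀ K n, fourierBasis.repr (T K) n = Φ (n / 2 ^ K) * a n)
    (hF : ∀ n, fourierBasis.repr F n = a n) : Tendsto T atTop (𝓝 F) := by
  have hdiff : ∀ K n, fourierCoeff ((T K - F : Lp ℂ 2 (AddCircle.haarAddCircle (T := (1 : ℝ))))) n =
      (Φ (n / 2 ^ K) - 1) * a n := by
    intro K n
    rw [← fourierBasis_repr, map_sub, lp.coeFn_sub, Pi.sub_apply, hT, hF]
    ring
  obtain ⟨C, hC⟩ := hΦ.exists_bound
  have hC0 : 0 ≤ C := (norm_nonneg _).trans (hC 0)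
  have hnorm : Tendsto (fun K => ‖T K - F‖ ^ 2) atTop (𝓝 0) := by
    have h := tendsto_tsum_of_dominated_convergence (𝓕 := atTop)
      (f := fun (K : ℕ) (n : ℤ) => ‖(Φ (n / 2 ^ K) - 1) * a n‖ ^ 2)
      (g := fun _ => (0 : ℝ)) (bound := fun n => (C + 1) ^ 2 * ‖a n‖ ^ 2)
      (ha.mul_left _) (fun n => ?_) (Eventually.of_forall fun K n => ?_)
    · simp only [← hdiff, (hasSum_sq_norm_fourierCoeff _).tsum_eq, tsum_zero] at h
      exact h
    · have h0 := (((hΦ.tendsto_div n).sub_const 1).mul_const (a n)).norm.pow 2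
      simpa using h0
    · rw [Real.norm_of_nonneg (by positivity), norm_mul, mul_pow]
      gcongr
      refine (norm_sub_le _ _).trans ?_
      rw [norm_one]
      gcongr
      exact hC _
  rw [tendsto_iff_norm_sub_tendsto_zero]
  have h := (Real.continuous_sqrt.tendsto 0).comp hnorm
  simpa only [Function.comp_def, Real.sqrt_sq (norm_nonneg _), Real.sqrt_zero] using h

lemma exists_fourierBasis_repr_eq {a : ℤ → ℂ} (ha : Summable (fun n => ‖a n‖ ^ 2)) :
    ∃ F : Lp ℂ 2 (AddCircle.haarAddCircle (T := (1 : ℝ))), ∀ n, fourierBasis.repr F n = a n := by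
  have hmem : Memℓp a 2 := by
    rw [memℓp_gen_iff (by simp)]
    simpa using ha
  refine ⟨fourierBasis.repr.symm (⟨a, hmem⟩ : lp (fun _ : ℤ => ℂ) 2), fun n => ?_⟩
  rw [LinearIsometryEquiv.apply_symm_apply]

lemma integrable_of_Lp_two (F : Lp ℂ 2 (AddCircle.haarAddCircle (T := (1 : ℝ)))) :
    Integrable F (volume : Measure UnitAddCircle) := by
  rw [volume_eq_haarAddCircle]
  exact (Lp.memLp F).integrable one_le_two

lemma tendsto_measure_norm_sub {α : Type*} [MeasurableSpace α] {μ : Measure α}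
    {T : ℕ → Lp ℂ 2 μ} {F : Lp ℂ 2 μ} (h : Tendsto T atTop (𝓝 F)) {ε : ℝ} (hε : 0 < ε) :
    Tendsto (fun K => μ {x | ε ≤ ‖T K x - F x‖}) atTop (𝓝 0) := by
  have h' : TendstoInMeasure μ (fun n => (T n : α → ℂ)) atTop F := tendstoInMeasure_of_tendsto_Lp h
  rw [tendstoInMeasure_iff_norm] at h'
  exact h' ε hε

/-- A distribution whose Littlewood–Paley blocks are square summable in the uniform norm is a
function, to which its Littlewood–Paley series converges in measure. The function is the one in
`L²` with the same Fourier coefficients. -/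
lemma exists_isFunction_and_tendsto {Φ : ℝ → ℂ} (hΦ : IsCutoff Φ) {u : TorusDistribution}
    (hu : Summable (fun k => ‖lpBlock Φ k u‖ ^ 2)) :
    ∃ f : UnitAddCircle → ℂ, u.IsFunction f ∧ ∀ ε : ℝ, 0 < ε → Tendsto (fun K : ℕ =>
      volume {x | ε ≤ ‖∑ k ∈ Finset.range (K + 1), lpBlock Φ k u x - f x‖}) atTop (𝓝 0) := by
  have hsum := summable_sq_coeff hΦ hu
  obtain ⟨F, hF⟩ := exists_fourierBasis_repr_eq hsum
  refine ⟨F, isFunction_of_fourierCoeff_eq (integrable_of_Lp_two F) fun n => ?_, ?_⟩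
  · rw [← hF, fourierBasis_repr]
  obtain ⟨T, hT⟩ : ∃ T : ℕ → Lp ℂ 2 (AddCircle.haarAddCircle (T := (1 : ℝ))), ∀ K, T K =
      ContinuousMap.toLp (E := ℂ) 2 (AddCircle.haarAddCircle (T := (1 : ℝ))) ℂ
        (∑ k ∈ Finset.range (K + 1), lpBlock Φ k u) := ⟨_, fun _ => rfl⟩
  have hlim := tendsto_of_fourierCoeff_sub hΦ hsum (F := F) (T := T)
    (fun K n => by rw [hT, fourierBasis_repr, fourierCoeff_toLp, fourierCoeff_sum_lpBlock hΦ]) hF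
  intro ε hε
  refine (tendsto_measure_norm_sub hlim hε).congr fun K => ?_
  rw [volume_eq_haarAddCircle]
  refine measure_congr ?_
  have hTK : T K =ᵐ[AddCircle.haarAddCircle]
      (∑ k ∈ Finset.range (K + 1), lpBlock Φ k u : C(UnitAddCircle, ℂ)) := by
    rw [hT]
    exact ContinuousMap.coeFn_toLp _ _
  filter_upwards [hTK] with x hx
  rw [ContinuousMap.coe_sum, Finset.sum_apply] at hx
  change (ε ≤ ‖T K x - F x‖) = (ε ≤ ‖_ - F x‖)
  rw [hx]

lemma summable_norm_lpBlock_sq {Φ : ℝ → ℂ} (hΦ : IsCutoff Φ) {q : ℝ} (hq : 0 < q) (hq2 : q ≤ 2)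
    {u : TorusDistribution} (hu : u ∈ besovSpace Φ q) :
    Summable (fun k => ‖lpBlock Φ k u‖ ^ 2) := by
  have h := summable_norm_lpBlock_rpow hΦ hq hu
  refine h.of_norm_bounded_eventually_nat ?_
  filter_upwards [h.tendsto_atTop_zero.eventually_le_const one_pos] with k hk
  rw [Real.norm_of_nonneg (by positivity), ← Real.rpow_two]
  have h1 : ‖lpBlock Φ k u‖ ≤ 1 := by
    by_contra! h1
    exact absurd hk (not_le.2 (Real.one_lt_rpow h1 hq))
  exact Real.rpow_le_rpow_of_exponent_ge_of_imp (norm_nonneg _) h1 hq2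
    (fun _ h0 => absurd h0 two_ne_zero)

/-! ### The upper bound for the growth envelope -/

/-- The terms above the threshold `τ` of a sequence in the unit ball of `ℓ^q`. -/
lemma sum_large_le {b : ℕ → ℝ} {q τ : ℝ} (hq : 1 ≤ q) (hτ : 0 < τ)
    (hb : ∀ s : Finset ℕ, ∑ k ∈ s, b k ^ q ≤ 1) (s : Finset ℕ) :
    ∑ k ∈ s, (if b k ≤ τ then 0 else b k) ≤ τ ^ (1 - q) := by
  have hle : ∀ k, (if b k ≤ τ then 0 else b k) ≤
      (if b k ≤ τ then 0 else b k ^ q) * τ ^ (1 - q) := by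
    intro k
    split_ifs with h
    · simp
    · rw [not_le] at h
      have hpos : 0 < b k := hτ.trans h
      calc b k = b k ^ q * b k ^ (1 - q) := by
            rw [← Real.rpow_add hpos]; simp
        _ ≤ b k ^ q * τ ^ (1 - q) := mul_le_mul_of_nonneg_left
            (Real.rpow_le_rpow_of_nonpos hτ h.le (by linarith)) (by positivity)
  refine (Finset.sum_le_sum fun k _ => hle k).trans ?_
  rw [← Finset.sum_mul]
  refine mul_le_of_le_one_left (by positivity) ?_
  refine le_trans (le_of_eq ?_) (hb (s.filter fun k => ¬ b k ≤ τ))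
  rw [Finset.sum_filter]
  exact Finset.sum_congr rfl fun k _ => by split_ifs <;> rfl

/-- The square sum of the terms up to the threshold `τ` of a sequence in the unit ball of `ℓ^q`. -/
lemma sum_sq_small_le {b : ℕ → ℝ} {q τ : ℝ} (hq1 : 1 ≤ q) (hq2 : q ≤ 2) (hτ : 0 < τ)
    (hb0 : ∀ k, 0 ≤ b k) (hb : ∀ s : Finset ℕ, ∑ k ∈ s, b k ^ q ≤ 1) (s : Finset ℕ) :
    ∑ k ∈ s, (if b k ≤ τ then b k else 0) ^ 2 ≤ τ ^ (2 - q) := by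
  have hle : ∀ k, (if b k ≤ τ then b k else 0) ^ 2 ≤ b k ^ q * τ ^ (2 - q) := by
    intro k
    have h0 := hb0 k
    split_ifs with h
    · rcases h0.eq_or_lt with h1 | h1
      · rw [← h1, Real.zero_rpow (by linarith)]; simp
      · calc b k ^ 2 = b k ^ q * b k ^ (2 - q) := by
              rw [← Real.rpow_add h1, ← Real.rpow_two]; congr 1; ring
          _ ≤ b k ^ q * τ ^ (2 - q) := by
              gcongr
    · rw [zero_pow two_ne_zero]
      positivity
  refine (Finset.sum_le_sum fun k _ => hle k).trans ?_
  rw [← Finset.sum_mul]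
  exact mul_le_of_le_one_left (by positivity) (hb s)

lemma sum_range_three_mul_add_one {E : Type*} [AddCommMonoid E] (F : ℕ → E) (N : ℕ) :
    ∑ k ∈ Finset.range (3 * N + 1), F k =
      F 0 + ∑ r ∈ Finset.range 3, ∑ j ∈ Finset.range N, F (3 * j + r + 1) := by
  induction N with
  | zero => simp
  | succ N ih =>
    rw [show 3 * (N + 1) + 1 = 3 * N + 1 + 1 + 1 + 1 by ring, Finset.sum_range_succ,
      Finset.sum_range_succ, Finset.sum_range_succ, ih]
    simp only [Finset.sum_range_succ, Finset.range_zero, Finset.sum_empty, zero_add, add_zero]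
    abel

/-- Frequencies of the blocks `3 * i + r + 1`, `i < j`, do not add up to those of the block
`3 * j + r + 1`. -/
lemma sum_two_pow_lt (r j : ℕ) : ∑ i ∈ Finset.range j, 2 ^ (3 * i + r + 2) < 2 ^ (3 * j + r) := by
  induction j with
  | zero => simp
  | succ j ih =>
    rw [Finset.sum_range_succ]
    have h1 : 2 ^ (3 * j + r + 2) = 4 * 2 ^ (3 * j + r) := by ring
    have h2 : 2 ^ (3 * (j + 1) + r) = 8 * 2 ^ (3 * j + r) := by ring
    omega

/-- The tail of the sum of the small blocks over one residue class modulo three. Within a class the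
blocks are lacunary, and their square sum is at most `τ ^ (2 - q)`. -/
lemma measure_small_class_le {Φ : ℝ → ℂ} (hΦ : IsCutoff Φ) {q : ℝ} (hq1 : 1 ≤ q) (hq2 : q ≤ 2)
    {u : TorusDistribution} (hu : besovNorm Φ q u ≤ 1) {τ : ℝ} (hτ : 0 < τ) (r N : ℕ) {s : ℝ}
    (hs : 0 ≤ s) :
    volume {x : UnitAddCircle | 2 * s < ‖∑ j ∈ Finset.range N,
      (if ‖lpBlock Φ (3 * j + r + 1) u‖ ≤ τ then lpBlock Φ (3 * j + r + 1) u else 0) x‖} ≤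
      4 * ENNReal.ofReal (Real.exp (-s ^ 2 / (2 * τ ^ (2 - q)))) := by
  have hb := sum_norm_lpBlock_rpow_le_one hΦ (by linarith) hu
  have hσ : (0 : ℝ) ≤ τ ^ (2 - q) := by positivity
  refine measure_lacunary_gt_le
    (g := fun j => if ‖lpBlock Φ (3 * j + r + 1) u‖ ≤ τ then lpBlock Φ (3 * j + r + 1) u else 0)
    (m := fun j => 2 ^ (3 * j + r)) (M := fun j => 2 ^ (3 * j + r + 2))
    (a := fun j => if ‖lpBlock Φ (3 * j + r + 1) u‖ ≤ τ then ‖lpBlock Φ (3 * j + r + 1) u‖ else 0)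
    (σ := ⟨τ ^ (2 - q), hσ⟩) (fun j => ?_) (sum_two_pow_lt r) (fun j x => ?_) ?_ hs
  · split_ifs
    · exact lpBlock_succ_mem_trigSpan hΦ _ u
    · exact Submodule.zero_mem _
  · split_ifs
    · exact ContinuousMap.norm_coe_le_norm _ x
    · simp
  · have hinj : Function.Injective (fun j => 3 * j + r + 1) := by
      intro i j h
      simp only at h
      omega
    have h := sum_sq_small_le hq1 hq2 hτ (fun k => norm_nonneg (lpBlock Φ k u)) hb
      ((Finset.range N).map ⟨_, hinj⟩)
    rw [Finset.sum_map] at h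
    exact h

/-- The partial sums of the Littlewood–Paley series split into the large blocks, the block of index
zero, which has norm at most one, and three lacunary sums of small blocks. -/
lemma norm_sum_lpBlock_le {Φ : ℝ → ℂ} (hΦ : IsCutoff Φ) {q : ℝ} (hq1 : 1 ≤ q)
    {u : TorusDistribution} (hu : besovNorm Φ q u ≤ 1) {τ : ℝ} (hτ : 0 < τ) (N : ℕ)
    (x : UnitAddCircle) :
    ‖∑ k ∈ Finset.range (3 * N + 1), lpBlock Φ k u x‖ ≤ τ ^ (1 - q) + 1 +
      ∑ r ∈ Finset.range 3, ‖∑ j ∈ Finset.range N,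
      (if ‖lpBlock Φ (3 * j + r + 1) u‖ ≤ τ then lpBlock Φ (3 * j + r + 1) u else 0) x‖ := by
  have hq0 : 0 < q := by linarith
  have hb := sum_norm_lpBlock_rpow_le_one hΦ hq0 hu
  have h0 : ‖lpBlock Φ 0 u‖ ≤ 1 := by
    have h := hb {0}
    rw [Finset.sum_singleton] at h
    by_contra! h1
    exact absurd h (not_le.2 (Real.one_lt_rpow h1 hq0))
  have hsplit : ∑ k ∈ Finset.range (3 * N + 1), lpBlock Φ k u x =
      ∑ k ∈ Finset.range (3 * N + 1), (if ‖lpBlock Φ k u‖ ≤ τ then 0 else lpBlock Φ k u) x +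
      ∑ k ∈ Finset.range (3 * N + 1), (if ‖lpBlock Φ k u‖ ≤ τ then lpBlock Φ k u else 0) x := by
    rw [← Finset.sum_add_distrib]
    exact Finset.sum_congr rfl fun k _ => by split_ifs <;> simp
  rw [hsplit, sum_range_three_mul_add_one
    (fun k => (if ‖lpBlock Φ k u‖ ≤ τ then lpBlock Φ k u else 0) x), ← add_assoc]
  refine (norm_add_le _ _).trans (add_le_add ((norm_add_le _ _).trans (add_le_add ?_ ?_))
    (norm_sum_le _ _))
  · refine (norm_sum_le _ _).trans (le_trans (Finset.sum_le_sum fun k _ => ?_)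
      (sum_large_le (b := fun k => ‖lpBlock Φ k u‖) hq1 hτ hb (Finset.range (3 * N + 1))))
    split_ifs
    · simp
    · exact ContinuousMap.norm_coe_le_norm _ x
  · split_ifs
    · exact (ContinuousMap.norm_coe_le_norm _ x).trans h0
    · simp

lemma half_le_rpow {L θ : ℝ} (hL : 1 / 2 ≤ L) (h0 : 0 ≤ θ) (h1 : θ ≤ 1) : 1 / 2 ≤ L ^ θ := by
  calc (1 / 2 : ℝ) = (1 / 2) ^ (1 : ℝ) := by simp
    _ ≤ (1 / 2) ^ θ := Real.rpow_le_rpow_of_exponent_ge (by norm_num) (by norm_num) h1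
    _ ≤ L ^ θ := by gcongr

/-- With the threshold `τ = L ^ (-1/q)`, the large blocks sum up to at most `L ^ (1 - 1/q)`, and
the small ones exceed a multiple of `L ^ (1 - 1/q)` on a set of measure at most
`12 * exp (-8 * L)`. -/
lemma measure_sum_lpBlock_gt_le {Φ : ℝ → ℂ} (hΦ : IsCutoff Φ) {q : ℝ} (hq1 : 1 ≤ q) (hq2 : q ≤ 2)
    {u : TorusDistribution} (hu : besovNorm Φ q u ≤ 1) {L : ℝ} (hL : Real.log 2 ≤ L) (N : ℕ) :
    volume {x : UnitAddCircle | 27 * L ^ (1 - 1 / q) <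
      ‖∑ k ∈ Finset.range (3 * N + 1), lpBlock Φ k u x‖} ≤ ENNReal.ofReal (Real.exp (-L) / 2) := by
  have hq0 : 0 < q := by linarith
  have hlog : (1 / 2 : ℝ) < Real.log 2 := by linarith [Real.log_two_gt_d9]
  have hL0 : 0 < L := by linarith
  set θ := 1 - 1 / q with hθ
  have hθ0 : 0 ≤ θ := by
    rw [hθ, sub_nonneg, div_le_one hq0]; exact hq1
  have hθ1 : θ ≤ 1 := by
    rw [hθ, sub_le_self_iff]; positivity
  set τ := L ^ (-(1 / q)) with hτ
  have hτ0 : 0 < τ := by positivity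
  have hτ1 : τ ^ (1 - q) = L ^ θ := by
    rw [hτ, ← Real.rpow_mul hL0.le, hθ]
    congr 1
    field_simp
    ring
  have hhalf := half_le_rpow (by linarith) hθ0 hθ1 (L := L)
  have hexp : -(4 * L ^ θ) ^ 2 / (2 * τ ^ (2 - q)) = -(8 * L) := by
    have h1 : (L ^ θ) ^ 2 = L * τ ^ (2 - q) := by
      rw [hτ, ← Real.rpow_mul hL0.le, ← Real.rpow_natCast, ← Real.rpow_mul hL0.le]
      nth_rw 2 [← Real.rpow_one L]
      rw [← Real.rpow_add hL0, hθ]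
      congr 1
      push_cast
      field_simp
      ring
    have h2 : 0 < τ ^ (2 - q) := by positivity
    rw [mul_pow, h1]
    field_simp
    norm_num
  have hclass : ∀ r, volume {x : UnitAddCircle | 2 * (4 * L ^ θ) < ‖∑ j ∈ Finset.range N,
      (if ‖lpBlock Φ (3 * j + r + 1) u‖ ≤ τ then lpBlock Φ (3 * j + r + 1) u else 0) x‖} ≤
      ENNReal.ofReal (4 * Real.exp (-(8 * L))) := by
    intro r
    have h := measure_small_class_le hΦ hq1 hq2 hu hτ0 r N (s := 4 * L ^ θ) (by positivity)
    rw [hexp] at h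
    rwa [ENNReal.ofReal_mul (by norm_num), ENNReal.ofReal_ofNat]
  calc volume {x : UnitAddCircle | 27 * L ^ θ <
      ‖∑ k ∈ Finset.range (3 * N + 1), lpBlock Φ k u x‖}
      ≤ volume (⋃ r ∈ Finset.range 3, {x : UnitAddCircle | 2 * (4 * L ^ θ) <
          ‖∑ j ∈ Finset.range N, (if ‖lpBlock Φ (3 * j + r + 1) u‖ ≤ τ then
            lpBlock Φ (3 * j + r + 1) u else 0) x‖}) := by
        refine measure_mono fun x hx => ?_
        by_contra hcon
        simp only [Set.mem_iUnion, not_exists] at hcon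
        have h1 := norm_sum_lpBlock_le hΦ hq1 hu hτ0 N x
        have h2 := Finset.sum_le_card_nsmul (Finset.range 3) (fun r => ‖∑ j ∈ Finset.range N,
          (if ‖lpBlock Φ (3 * j + r + 1) u‖ ≤ τ then lpBlock Φ (3 * j + r + 1) u else 0) x‖)
          (2 * (4 * L ^ θ)) fun r hr => not_lt.1 (hcon r hr)
        rw [Finset.card_range, nsmul_eq_mul] at h2
        have h3 : 27 * L ^ θ < _ := hx
        push_cast at h2
        rw [hτ1] at h1
        -- `27 = 1 + 2 + 3 * 8`: the large blocks, the block of index zero, for which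
        -- `1 ≤ 2 * L ^ θ`, and the three residue classes.
        linarith
    _ ≤ ∑ r ∈ Finset.range 3, ENNReal.ofReal (4 * Real.exp (-(8 * L))) :=
        (measure_biUnion_finset_le _ _).trans (Finset.sum_le_sum fun r _ => hclass r)
    _ = ENNReal.ofReal (12 * Real.exp (-(8 * L))) := by
        rw [Finset.sum_const, Finset.card_range, ← ENNReal.ofReal_nsmul, nsmul_eq_mul]
        congr 1
        push_cast
        ring
    _ ≤ ENNReal.ofReal (Real.exp (-L) / 2) := by
        refine ENNReal.ofReal_le_ofReal ?_
        -- `exp (-8 * L) = exp (-L) * exp (-L) ^ 7` and `exp (-L) ≤ 1 / 2`.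
        have h1 : Real.exp (-L) ≤ 1 / 2 := by
          rw [← Real.exp_log (by norm_num : (0 : ℝ) < 1 / 2)]
          refine Real.exp_le_exp.2 ?_
          rw [Real.log_div one_ne_zero two_ne_zero, Real.log_one]
          linarith
        have h2 : Real.exp (-(8 * L)) = Real.exp (-L) * Real.exp (-L) ^ 7 := by
          rw [← pow_succ', ← Real.exp_nat_mul]
          congr 1
          push_cast
          ring
        have h3 : Real.exp (-L) ^ 7 ≤ (1 / 2) ^ 7 := by gcongr
        have h4 := Real.exp_pos (-L)
        rw [h2]
        nlinarith

/-- Every function in the unit ball has the required rearrangement bound. -/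
lemma rearrangement_le {Φ : ℝ → ℂ} (hΦ : IsCutoff Φ) {q : ℝ} (hq1 : 1 ≤ q) (hq2 : q ≤ 2)
    {u : TorusDistribution} (hu : besovNorm Φ q u ≤ 1) {f : UnitAddCircle → ℂ}
    (hf : u.IsFunction f) {t : ℝ} (ht0 : 0 < t) (ht : t ≤ 1 / 2) :
    rearrangement f t ≤ ENNReal.ofReal (28 * |Real.log t| ^ (1 - 1 / q)) := by
  have hq0 : 0 < q := by linarith
  have hL : Real.log 2 ≤ -Real.log t := by
    have h := Real.log_le_log ht0 ht
    rw [Real.log_div one_ne_zero two_ne_zero, Real.log_one] at h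
    linarith
  have hlog : (0 : ℝ) < Real.log 2 := Real.log_pos one_lt_two
  have habs : |Real.log t| = -Real.log t := abs_of_nonpos (by linarith)
  rw [habs]
  set L := -Real.log t with hLdef
  have hL0 : 0 < L := by linarith
  have hexp : Real.exp (-L) = t := by rw [hLdef, neg_neg, Real.exp_log ht0]
  set P := L ^ (1 - 1 / q) with hP
  have hP0 : 0 < P := by positivity
  have hmem : u ∈ besovSpace Φ q := lt_of_le_of_lt hu ENNReal.one_lt_top
  obtain ⟨g, hg, hlim⟩ := exists_isFunction_and_tendsto hΦ
    (summable_norm_lpBlock_sq hΦ hq0 hq2 hmem)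
  have hae := hf.ae_eq hg
  have hev := (hlim P hP0).eventually_le_const
    (u := ENNReal.ofReal (t / 2)) (ENNReal.ofReal_pos.2 (by linarith))
  obtain ⟨K, hK⟩ := eventually_atTop.1 hev
  have hK' := hK (3 * K) (by omega)
  refine sInf_le ?_
  change volume {x | ENNReal.ofReal (28 * P) < ‖f x‖ₑ} ≤ ENNReal.ofReal t
  calc volume {x | ENNReal.ofReal (28 * P) < ‖f x‖ₑ}
      ≤ volume ({x | 27 * P < ‖∑ k ∈ Finset.range (3 * K + 1), lpBlock Φ k u x‖} ∪
          {x | P ≤ ‖∑ k ∈ Finset.range (3 * K + 1), lpBlock Φ k u x - g x‖}) := by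
        refine measure_mono_ae ?_
        filter_upwards [hae] with x hx hmemx
        have h1 : ENNReal.ofReal (28 * P) < ‖f x‖ₑ := hmemx
        rw [← ofReal_norm, ENNReal.ofReal_lt_ofReal_iff_of_nonneg (by positivity), hx] at h1
        by_contra hcon
        have h2 : ¬ (27 * P < ‖∑ k ∈ Finset.range (3 * K + 1), lpBlock Φ k u x‖ ∨
          P ≤ ‖∑ k ∈ Finset.range (3 * K + 1), lpBlock Φ k u x - g x‖) := hcon
        push Not at h2
        have h3 := norm_sub_norm_le (g x) (∑ k ∈ Finset.range (3 * K + 1), lpBlock Φ k u x)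
        rw [norm_sub_rev (g x)] at h3
        linarith
    _ ≤ ENNReal.ofReal (t / 2) + ENNReal.ofReal (t / 2) := by
        refine (measure_union_le _ _).trans (add_le_add ?_ hK')
        have h := measure_sum_lpBlock_gt_le hΦ hq1 hq2 hu hL K
        rwa [hexp] at h
    _ = ENNReal.ofReal t := by
        rw [← ENNReal.ofReal_add (by linarith) (by linarith), add_halves]

/-! ### The lower bound for the growth envelope -/

lemma dyadicCutoff_two_pow {Φ : ℝ → ℂ} (hΦ : IsCutoff Φ) (j m : ℕ) :
    dyadicCutoff Φ j (2 ^ m) = if j = m then 1 else 0 := by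
  have habs : ∀ m : ℕ, |(2 : ℝ) ^ m| = 2 ^ m := fun m => abs_of_pos (by positivity)
  have hlt : ∀ j < m, dyadicCutoff Φ j (2 ^ m) = 0 := fun j h => by
    refine dyadicCutoff_eq_zero_of_le hΦ j ?_
    rw [habs]
    exact pow_le_pow_right₀ one_le_two h
  rcases lt_trichotomy j m with h | rfl | h
  · rw [if_neg h.ne, hlt j h]
  · have hs := sum_dyadicCutoff Φ j (2 ^ j)
    rw [hΦ.div_eq_one (habs j).le, Finset.sum_range_succ, Finset.sum_eq_zero, zero_add] at hs
    · simpa using hs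
    · exact fun i hi => hlt i (Finset.mem_range.1 hi)
  · rw [if_neg h.ne']
    obtain ⟨i, rfl⟩ := Nat.exists_eq_succ_of_ne_zero (Nat.ne_zero_of_lt h)
    refine dyadicCutoff_succ_eq_zero_of_le hΦ i ?_
    rw [habs]
    exact pow_le_pow_right₀ one_le_two (Nat.lt_succ_iff.1 h)

/-- The normalized lacunary sum `N ^ (-1/q) * ∑ e ^ (2 π i 2 ^ k x)`, `k < N`; it has Besov norm
at most one since its `k`-th Littlewood–Paley block is its `k`-th term. -/
def lacunarySum (q : ℝ) (N : ℕ) : C(UnitAddCircle, ℂ) :=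
  (((N : ℝ) ^ (-(1 / q)) : ℝ) : ℂ) • ∑ k ∈ Finset.range N, fourier (2 ^ k)

lemma fourierCoeff_lacunarySum (q : ℝ) (N : ℕ) (n : ℤ) :
    fourierCoeff (lacunarySum q N) n =
      (((N : ℝ) ^ (-(1 / q)) : ℝ) : ℂ) * ∑ k ∈ Finset.range N, if n = 2 ^ k then 1 else 0 := by
  have h := fourierCoeff.sum (T := 1) (Finset.range N)
    (fun k => (fourier (2 ^ k) : UnitAddCircle → ℂ)) (fun m _ => by
      rw [← volume_eq_haarAddCircle]; exact integrable_continuousMap _)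
  rw [lacunarySum, ContinuousMap.coe_smul, fourierCoeff.const_smul, ContinuousMap.coe_sum, h,
    Finset.sum_apply, smul_eq_mul]
  congr 1
  refine Finset.sum_congr rfl fun k _ => ?_
  rw [fourierCoeff_fourier, Pi.single_apply]

lemma besovNorm_lacunarySum_le {Φ : ℝ → ℂ} (hΦ : IsCutoff Φ) {q : ℝ} (hq : 0 < q) {N : ℕ}
    (hN : 0 < N) :
    besovNorm Φ q (ofFunction (lacunarySum q N) (integrable_continuousMap _)) ≤ 1 := by
  set u := ofFunction (lacunarySum q N) (integrable_continuousMap _) with hu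
  have hcoeff : ∀ (j : ℕ) (n : ℤ), dyadicCutoff Φ j (n : ℝ) * u.coeff n =
      if j < N ∧ n = 2 ^ j then (((N : ℝ) ^ (-(1 / q)) : ℝ) : ℂ) else 0 := by
    intro j n
    rw [(isFunction_ofFunction (integrable_continuousMap _)).coeff_eq, fourierCoeff_lacunarySum,
      mul_left_comm, Finset.mul_sum]
    have h : ∀ k ∈ Finset.range N, dyadicCutoff Φ j (n : ℝ) * (if n = 2 ^ k then 1 else 0) =
        if j = k then (if n = 2 ^ j then 1 else 0) else 0 := by
      intro k _
      by_cases hk : n = 2 ^ k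
      · subst hk
        push_cast
        rw [dyadicCutoff_two_pow hΦ]
        by_cases hjk : j = k <;> simp [hjk]
      · by_cases hjk : j = k
        · subst hjk; simp [hk]
        · simp [hk, hjk]
    rw [Finset.sum_congr rfl h, Finset.sum_ite_eq]
    simp only [Finset.mem_range]
    by_cases h1 : j < N <;> by_cases h2 : n = 2 ^ j <;> simp [h1, h2]
  have hblock : ∀ j, ‖lpBlock Φ j u‖ ≤ if j < N then (N : ℝ) ^ (-(1 / q)) else 0 := by
    intro j
    have hnorm : ‖(((N : ℝ) ^ (-(1 / q)) : ℝ) : ℂ)‖ = (N : ℝ) ^ (-(1 / q)) := by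
      rw [Complex.norm_real, Real.norm_of_nonneg (by positivity)]
    rw [lpBlock]
    simp only [hcoeff]
    refine (norm_sum_le _ _).trans ?_
    simp only [norm_smul, fourier_norm, mul_one]
    by_cases hj : j < N
    · simp only [hj, true_and, if_true]
      rw [Finset.sum_congr rfl fun n _ => apply_ite norm (n = 2 ^ j) _ _,
        norm_zero, Finset.sum_ite_eq']
      split_ifs
      · exact hnorm.le
      · positivity
    · simp [hj]
  rw [besovNorm_eq hΦ]
  refine ENNReal.rpow_le_one ?_ (by positivity)
  rw [tsum_eq_sum (s := Finset.range N)]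
  · have hterm : ∀ j ∈ Finset.range N, ‖lpBlock Φ j u‖ₑ ^ q ≤ (N : ℝ≥0∞)⁻¹ := by
      intro j hj
      have h := hblock j
      rw [if_pos (Finset.mem_range.1 hj)] at h
      have hN' : (0 : ℝ) < N := by exact_mod_cast hN
      calc ‖lpBlock Φ j u‖ₑ ^ q = ENNReal.ofReal (‖lpBlock Φ j u‖ ^ q) := by
            rw [← ofReal_norm, ENNReal.ofReal_rpow_of_nonneg (norm_nonneg _) hq.le]
        _ ≤ ENNReal.ofReal ((N : ℝ)⁻¹) := by
            refine ENNReal.ofReal_le_ofReal ?_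
            calc ‖lpBlock Φ j u‖ ^ q ≤ ((N : ℝ) ^ (-(1 / q))) ^ q := by gcongr
              _ = (N : ℝ)⁻¹ := by
                rw [← Real.rpow_mul hN'.le, ← Real.rpow_neg_one]
                congr 1
                field_simp
        _ = (N : ℝ≥0∞)⁻¹ := by
            rw [ENNReal.ofReal_inv_of_pos hN', ENNReal.ofReal_natCast]
    refine (Finset.sum_le_card_nsmul _ _ _ hterm).trans ?_
    rw [Finset.card_range, nsmul_eq_mul]
    exact ENNReal.mul_inv_le_one _
  · intro j hj
    have h := hblock j
    rw [if_neg (by simpa using hj)] at h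
    have h0 : ‖lpBlock Φ j u‖ₑ = 0 := by
      rw [← ofReal_norm, ENNReal.ofReal_eq_zero]; exact h
    rw [h0, ENNReal.zero_rpow_of_pos hq]

lemma le_rearrangement {f : UnitAddCircle → ℂ} {t s : ℝ}
    (h : ENNReal.ofReal t < volume {x : UnitAddCircle | s ≤ ‖f x‖}) :
    ENNReal.ofReal s ≤ rearrangement f t := by
  refine le_sInf fun b hb => ?_
  by_contra! hlt
  refine absurd (h.trans_le (measure_mono fun x hx => ?_)) (not_lt.2 hb)
  change b < ‖f x‖ₑ
  refine hlt.trans_le ?_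
  rw [← ofReal_norm]
  exact ENNReal.ofReal_le_ofReal hx

lemma le_growthEnvelope {Φ : ℝ → ℂ} (hΦ : IsCutoff Φ) {q : ℝ} (hq : 0 < q) {N : ℕ}
    (hN : 0 < N) {t s : ℝ}
    (h : ENNReal.ofReal t < volume {x : UnitAddCircle | s ≤ ‖lacunarySum q N x‖}) :
    ENNReal.ofReal s ≤ growthEnvelope Φ q t := by
  have hb := besovNorm_lacunarySum_le hΦ hq hN
  exact (le_rearrangement h).trans (le_sSup ⟨_, _, hb.trans_lt ENNReal.one_lt_top, hb,
    isFunction_ofFunction (integrable_continuousMap _), rfl⟩)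

/-- Close to the origin all exponentials in the lacunary sum have real part at least `1 / 2`. -/
lemma le_norm_lacunarySum {q : ℝ} {N : ℕ} (hN : 0 < N) {x : UnitAddCircle}
    (hx : ‖x‖ ≤ 1 / (4 * 2 ^ N)) : (N : ℝ) ^ (1 - 1 / q) / 2 ≤ ‖lacunarySum q N x‖ := by
  obtain ⟨y, rfl, hy⟩ : ∃ y : ℝ, (y : UnitAddCircle) = x ∧ |y| ≤ 1 / (4 * 2 ^ N) := by
    induction x using QuotientAddGroup.induction_on with | H y => ?_
    refine ⟨y - round y, ?_, ?_⟩
    · have h : ((round y : ℝ) : UnitAddCircle) = 0 := by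
        have := AddCircle.coe_eq_zero_iff (1 : ℝ) (x := (round y : ℝ))
        exact this.2 ⟨round y, by simp⟩
      rw [AddCircle.coe_sub, h, sub_zero]
    · rw [← UnitAddCircle.norm_eq]
      exact hx
  have hN' : (0 : ℝ) < N := by exact_mod_cast hN
  have hre : ∀ k ∈ Finset.range N, (1 / 2 : ℝ) ≤ (fourier (2 ^ k) (y : UnitAddCircle) : ℂ).re := by
    intro k hk
    have hform : (fourier (2 ^ k) (y : UnitAddCircle) : ℂ) =
        Complex.exp ((2 * Real.pi * 2 ^ k * y : ℝ) * Complex.I) := by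
      rw [fourier_coe_apply]
      congr 1
      push_cast
      ring
    rw [hform, Complex.exp_ofReal_mul_I_re]
    have hk2 : (2 : ℝ) ^ k * 2 ≤ 2 ^ N := by
      rw [← pow_succ]
      exact pow_le_pow_right₀ one_le_two (Finset.mem_range.1 hk)
    have hbound : |2 * Real.pi * 2 ^ k * y| ≤ 1 := by
      rw [abs_mul, abs_of_pos (by positivity)]
      rw [le_div_iff₀ (by positivity)] at hy
      have hpi := Real.pi_lt_four
      calc 2 * Real.pi * 2 ^ k * |y| ≤ 2 * 4 * 2 ^ k * |y| := by gcongr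
        _ = |y| * (4 * (2 ^ k * 2)) := by ring
        _ ≤ |y| * (4 * 2 ^ N) := by gcongr
        _ ≤ 1 := hy
    have hsq : (2 * Real.pi * 2 ^ k * y) ^ 2 ≤ 1 := (sq_le_one_iff_abs_le_one _).2 hbound
    have hcos := Real.one_sub_sq_div_two_le_cos (x := 2 * Real.pi * 2 ^ k * y)
    linarith
  have hval : lacunarySum q N (y : UnitAddCircle) = (((N : ℝ) ^ (-(1 / q)) : ℝ) : ℂ) *
      ∑ k ∈ Finset.range N, fourier (2 ^ k) (y : UnitAddCircle) := by
    simp [lacunarySum]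
  rw [hval]
  refine le_trans ?_ (Complex.re_le_norm _)
  rw [Complex.re_ofReal_mul, Complex.re_sum]
  have hsum := Finset.card_nsmul_le_sum _ _ _ hre
  rw [Finset.card_range, nsmul_eq_mul] at hsum
  calc (N : ℝ) ^ (1 - 1 / q) / 2 = (N : ℝ) ^ (-(1 / q)) * (N * (1 / 2)) := by
        rw [sub_eq_neg_add, Real.rpow_add hN', Real.rpow_one]; ring
    _ ≤ _ := by gcongr

lemma ofReal_lt_volume_lacunarySum {q : ℝ} {N : ℕ} (hN : 3 ≤ N) {t : ℝ}
    (ht : t ≤ Real.exp (-N)) : ENNReal.ofReal t <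
      volume {x : UnitAddCircle | (N : ℝ) ^ (1 - 1 / q) / 2 ≤ ‖lacunarySum q N x‖} := by
  have h2N : (1 : ℝ) ≤ 2 ^ N := one_le_pow₀ one_le_two
  have hlt : t < 2 * (1 / (4 * 2 ^ N)) := by
    have he : Real.exp (-1) ≤ 37 / 100 := by
      rw [Real.exp_neg]
      rw [inv_le_comm₀ (Real.exp_pos _) (by norm_num)]
      linarith [Real.exp_one_gt_d9]
    have h1 : Real.exp (-N) = Real.exp (-1) ^ N := by
      rw [← Real.exp_nat_mul]; congr 1; ring
    have h3 : (2 * Real.exp (-1)) ^ N < 1 / 2 := by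
      calc (2 * Real.exp (-1)) ^ N ≤ (2 * (37 / 100)) ^ N := by gcongr
        _ ≤ (2 * (37 / 100)) ^ 3 := pow_le_pow_of_le_one (by norm_num) (by norm_num) hN
        _ < 1 / 2 := by norm_num
    rw [mul_pow, ← h1] at h3
    rw [mul_one_div, lt_div_iff₀ (by positivity)]
    nlinarith
  calc ENNReal.ofReal t < ENNReal.ofReal (min 1 (2 * (1 / (4 * 2 ^ N)))) := by
        refine (ENNReal.ofReal_lt_ofReal_iff ?_).2 (lt_min ?_ hlt)
        · positivity
        · refine lt_of_lt_of_le hlt ?_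
          rw [mul_one_div, div_le_one (by positivity)]
          linarith
    _ = volume (Metric.closedBall (0 : UnitAddCircle) (1 / (4 * 2 ^ N))) :=
        (AddCircle.volume_closedBall (1 : ℝ) _).symm
    _ ≤ _ := by
        refine measure_mono fun x hx => ?_
        rw [mem_closedBall_zero_iff] at hx
        exact le_norm_lacunarySum (by omega) hx

/-- The lower bound: for small `t` the lacunary sum of `N = ⌊|log t|⌋` terms is large on an interval
of length `2 ^ (-N - 1)`, which exceeds `exp (-N) ≥ t`. -/
lemma growthEnvelope_ge {Φ : ℝ → ℂ} (hΦ : IsCutoff Φ) {q : ℝ} (hq1 : 1 ≤ q) {t : ℝ}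
    (ht0 : 0 < t) (ht : t ≤ 1 / 2) :
    ENNReal.ofReal (1 / 4 * |Real.log t| ^ (1 - 1 / q)) ≤ growthEnvelope Φ q t := by
  have hq0 : 0 < q := by linarith
  have habs : |Real.log t| = -Real.log t := abs_of_nonpos (Real.log_nonpos ht0.le (by linarith))
  set L := |Real.log t| with hL
  have hL0 : 0 ≤ L := abs_nonneg _
  set θ := 1 - 1 / q with hθ
  have hθ0 : 0 ≤ θ := by
    rw [hθ, sub_nonneg, div_le_one hq0]; exact hq1
  have hθ1 : θ ≤ 1 := by
    rw [hθ, sub_le_self_iff]; positivity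
  rcases lt_or_ge L 3 with h3 | h3
  · -- For `t` bounded below, a single exponential suffices.
    have hle : 1 / 4 * L ^ θ ≤ 1 := by
      have h1 : L ^ θ ≤ 3 ^ θ := by gcongr
      have h2 : (3 : ℝ) ^ θ ≤ 3 ^ (1 : ℝ) := Real.rpow_le_rpow_of_exponent_le (by norm_num) hθ1
      rw [Real.rpow_one] at h2
      linarith
    refine (ENNReal.ofReal_le_ofReal hle).trans (le_growthEnvelope hΦ hq0 one_pos ?_)
    have huniv : {x : UnitAddCircle | (1 : ℝ) ≤ ‖lacunarySum q 1 x‖} = Set.univ := by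
      refine Set.eq_univ_of_forall fun x => ?_
      change (1 : ℝ) ≤ ‖lacunarySum q 1 x‖
      have h1 : ‖(fourier 1 x : ℂ)‖ = 1 := by rw [fourier_apply]; exact Circle.norm_coe _
      have h2 : lacunarySum q 1 x = fourier 1 x := by simp [lacunarySum]
      rw [h2, h1]
    rw [huniv, UnitAddCircle.measure_univ, ← ENNReal.ofReal_one]
    exact (ENNReal.ofReal_lt_ofReal_iff one_pos).2 (by linarith)
  · set N := ⌊L⌋₊ with hN
    have hN3 : 3 ≤ N := Nat.le_floor (by exact_mod_cast h3)
    have hNL : (N : ℝ) ≤ L := Nat.floor_le hL0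
    have hLN : L / 2 ≤ N := by
      have h1 := Nat.lt_floor_add_one L
      linarith
    have hle : 1 / 4 * L ^ θ ≤ (N : ℝ) ^ θ / 2 := by
      have h1 : L ^ θ / 2 ≤ (N : ℝ) ^ θ := by
        calc L ^ θ / 2 = L ^ θ * (1 / 2) ^ (1 : ℝ) := by rw [Real.rpow_one]; ring
          _ ≤ L ^ θ * (1 / 2) ^ θ := mul_le_mul_of_nonneg_left
              (Real.rpow_le_rpow_of_exponent_ge (by norm_num) (by norm_num) hθ1) (by positivity)
          _ = (L / 2) ^ θ := by
              rw [← Real.mul_rpow hL0 (by norm_num)]; congr 1; ring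
          _ ≤ (N : ℝ) ^ θ := by gcongr
      linarith
    refine (ENNReal.ofReal_le_ofReal hle).trans (le_growthEnvelope hΦ hq0 (by omega)
      (ofReal_lt_volume_lacunarySum hN3 ?_))
    calc t = Real.exp (-L) := by rw [habs, neg_neg, Real.exp_log ht0]
      _ ≤ Real.exp (-N) := Real.exp_le_exp.2 (neg_le_neg hNL)

end LowReg

end

theorem corollary1p2 (Φ : ℝ → ℂ) (hΦ : LowReg.IsCutoff Φ) (q : ℝ) (hq1 : 1 ≤ q) (hq2 : q ≤ 2) :
    (∀ u ∈ LowReg.besovSpace Φ q, ∃ f : UnitAddCircle → ℂ, u.IsFunction f) ∧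
    ∃ c C : ℝ, 0 < c ∧ 0 < C ∧ ∀ t : ℝ, 0 < t → t ≤ 1 / 2 →
      ENNReal.ofReal (c * |Real.log t| ^ (1 - 1 / q)) ≤ LowReg.growthEnvelope Φ q t ∧
      LowReg.growthEnvelope Φ q t ≤ ENNReal.ofReal (C * |Real.log t| ^ (1 - 1 / q)) := by
  have hq0 : 0 < q := by linarith
  refine ⟨fun u hu => ?_, 1 / 4, 28, by norm_num, by norm_num, fun t ht0 ht => ⟨?_, ?_⟩⟩
  · obtain ⟨f, hf, -⟩ := LowReg.exists_isFunction_and_tendsto hΦ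
      (LowReg.summable_norm_lpBlock_sq hΦ hq0 hq2 hu)
    exact ⟨f, hf⟩
  · exact LowReg.growthEnvelope_ge hΦ hq1 ht0 ht
  · refine sSup_le ?_
    rintro _ ⟨u, f, -, hu, hf, rfl⟩
    exact LowReg.rearrangement_le hΦ hq1 hq2 hu hf ht0 ht
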